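/- Let $I=[0,1]$ with Lebesgue measure $\mu$, and let $\mathcal D$ be the collection of all dyadic subintervals $J$ of $I$. For $J\in\mathcal D$ let $h_J$ be the Haar function equal to $-1$ on the left half of $J$, $+1$ on the right half of $J$, and $0$ outside $J$. For an integrable $f\colon I\to\mathbb R$ put $a_J=\mu(J)^{-1}\int_I f h_J$ and define the dyadic square function $Sf=\bigl(\sum_{J\in\mathcal D}a_J^2\chi_J\bigr)^{1/2}$. For $x\in\mathbb R$ let $$\mathcal B(x)=\sup\Bigl\{\mu\{f\ge x\}\colon f\in L^1(I),\ \int_I f=0,\ \|Sf\|_{L^\infty(I)}\le 1\Bigr\}.$$ Let $M[a,b]=\dfrac{a+b}{\sqrt{4+(a-b)^2}}$, and for $n\ge1$ let $D_n=\{k2^{-n}\colon k=0,1,\dots,2^{n-1}\}$ and $D=\bigcup_{n\ge1}D_n$. Define $\mathcal A$ on $D$ by $\mathcal A(0)=0$, $\mathcal A(\frac12)=1$ and, inductively for $n\ge 2$, $\mathcal A(t)=M[\mathcal A(t-2^{-n}),\mathcal A(t+2^{-n})]$ for $t\in D_n\setminus D_{n-1}$. Then: 1. $\mathcal A$ extends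 by continuity from $D$ to $[0,\frac12]$, and the extension (the "dyadic suspension bridge", again denoted $\mathcal A$) is a continuous strictly increasing bijection of $[0,\frac12]$ onto $[0,1]$; thus $\mathcal A^{-1}\colon[0,1]\to[0,\frac12]$ is well defined. 2. $\mathcal B(x)=1-\mathcal A^{-1}(x)$ for all $x\in[0,1]$. 3. The set of points $x\in(0,1)$ at which both one-sided derivatives of $\mathcal B$ exist (as finite numbers) and are different is dense in $[0,1]$. -/

import Mathlib

open Set Filter Topology MeasureTheory
open scoped ENNReal

noncomputable section

/-! ### Dyadic intervals, Haar functions, square function -/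

/-- The dyadic subinterval `[k / 2 ^ n, (k + 1) / 2 ^ n)` of the unit interval (for `k < 2 ^ n`). -/
def dyadicInterval (n k : ℕ) : Set ℝ :=
  Ico ((k : ℝ) / 2 ^ n) (((k : ℝ) + 1) / 2 ^ n)

/-- The Haar function of the dyadic interval `dyadicInterval n k`: it is `-1` on the left half,
`+1` on the right half, and `0` outside. -/
def haar (n k : ℕ) (t : ℝ) : ℝ :=
  (dyadicInterval (n + 1) (2 * k + 1)).indicator 1 t - (dyadicInterval (n + 1) (2 * k)).indicator 1 t

/-- The Haar coefficient `a_J = μ(J)⁻¹ ∫_I f h_J` for `J = dyadicInterval n k`, `I = [0, 1]`. -/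
def haarCoeff (f : ℝ → ℝ) (n k : ℕ) : ℝ :=
  (volume.real (dyadicInterval n k))⁻¹ * ∫ t in Icc (0 : ℝ) 1, f t * haar n k t

/-- The dyadic square function `Sf = (∑_J a_J ^ 2 χ_J) ^ (1/2)`, the sum being over all dyadic
subintervals of the unit interval; it takes values in `[0, ∞]`. -/
def dyadicSquareFunction (f : ℝ → ℝ) (t : ℝ) : ℝ≥0∞ :=
  (∑' n : ℕ, ∑ k ∈ Finset.range (2 ^ n),
    (dyadicInterval n k).indicator (fun _ => ENNReal.ofReal (haarCoeff f n k ^ 2)) t) ^ (1 / 2 : ℝ)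

/-- `f` is integrable on `I = [0, 1]`, has mean zero there, and `‖Sf‖_{L^∞(I)} ≤ 1`. -/
structure IsTestFunction (f : ℝ → ℝ) : Prop where
  integrable : IntegrableOn f (Icc 0 1) volume
  mean_zero : ∫ t in Icc (0 : ℝ) 1, f t = 0
  square_le : essSup (dyadicSquareFunction f) (volume.restrict (Icc 0 1)) ≤ 1

/-- The Bellman function `𝓑(x) = sup { μ {f ≥ x} : ∫_I f = 0, ‖Sf‖_∞ ≤ 1 }`. -/
def bellman (x : ℝ) : ℝ :=
  sSup {m : ℝ | ∃ f : ℝ → ℝ, IsTestFunction f ∧ m = volume.real {t ∈ Icc (0 : ℝ) 1 | x ≤ f t}}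

/-! ### The dyadic suspension bridge -/

/-- The nonlinear mean `M[a, b]`. -/
def nonlinearMean (a b : ℝ) : ℝ :=
  (a + b) / √(4 + (a - b) ^ 2)

/-- `dyadicGrid n` is the set of points `k / 2 ^ (n + 1)`, `0 ≤ k ≤ 2 ^ n`, of `[0, 1/2]`. -/
def dyadicGrid (n : ℕ) : Set ℝ :=
  {t | ∃ k : ℕ, k ≤ 2 ^ n ∧ t = (k : ℝ) / 2 ^ (n + 1)}

/-- The set of binary rational numbers of `[0, 1/2]`. -/
def dyadicPoints : Set ℝ := ⋃ n, dyadicGrid n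

open Classical in
/-- The values of the suspension bridge on `dyadicGrid n` (values elsewhere are irrelevant):
`0 ↦ 0` and `1/2 ↦ 1` on `dyadicGrid 0`, and at a new point `t` of `dyadicGrid (n + 1)` the
value is `M` of the values at the neighbours `t ± 2 ^ (-(n + 2))`, which lie in `dyadicGrid n`. -/
def bridgeOnGrid : ℕ → ℝ → ℝ
  | 0, t => if t = 0 then 0 else 1
  | n + 1, t =>
      if t ∈ dyadicGrid n then bridgeOnGrid n t
      else nonlinearMean (bridgeOnGrid n (t - 1 / 2 ^ (n + 2))) (bridgeOnGrid n (t + 1 / 2 ^ (n + 2)))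

/-- The suspension bridge on binary rationals: use the first grid containing the point. -/
def bridgeOnDyadics (t : ℝ) : ℝ :=
  bridgeOnGrid (sInf {n : ℕ | t ∈ dyadicGrid n}) t

/-- The dyadic suspension bridge `𝓐 : [0, 1/2] → [0, 1]`: the extension by continuity of
`bridgeOnDyadics` (only the values on `[0, 1/2]` are meaningful). -/
def suspensionBridge : ℝ → ℝ :=
  extendFrom dyadicPoints bridgeOnDyadics

/-- `g` has a derivative jump at `x`: both one-sided derivatives exist (and are finite), and they
are different. -/
def HasDerivJumpAt (g : ℝ → ℝ) (x : ℝ) : Prop :=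
  ∃ l r : ℝ, HasDerivWithinAt g l (Iio x) x ∧ HasDerivWithinAt g r (Ioi x) x ∧ l ≠ r

end

/-!
Write `M` for `nonlinearMean`, `A` for `suspensionBridge` and `T` for its inverse `bridgeInv`.

A mean-zero `f` with `Sf ≤ 1` is a dyadic martingale. Having reached the average `m` after spending
the part `s` of the budget `1` of square jumps, it still has to climb `y - m` with the budget
`1 - s`, and by scaling only the quotient `(y - m) / √(1 - s)` matters. A jump `± a` replaces the
quotient by two quotients `p`, `q`, and `M p q` is exactly the quotient before the jump. So the
optimal measure `1 - T` is governed by the inequality `T (M p q) ≤ (T p + T q) / 2`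
(`bridgeInv_mean_le`), in which equality holds at neighbouring points of a dyadic grid by the
definition of `A`.

* *The main inequality.* For `p, q` in `[0, 1]` it says `M (A s) (A t) ≤ A ((s + t) / 2)`
  (`suspensionBridge_three_point`). On the grids this follows by induction on the level
  (`bridgeSeq_three_point`) from the four-point inequality
  `M (M a₁ a₂) (M b₁ b₂) ≤ M (M a₁ b₂) (M a₂ b₁)` for `0 ≤ a₁ ≤ a₂ ≤ b₁ ≤ b₂ ≤ 1`
  (`nonlinearMean_four_point`). The quotients of a martingale may leave `[0, 1]`, so `T` is extended
  by `0` to the left and by the Chebyshev-Cantelli function `x ^ 2 / (1 + x ^ 2)` to the right. The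
  mixed case of the inequality (`bridge_ge_mean_of_gt_one`) uses that a suitable function of `A` is
  concave, since `M` dominates the corresponding quasi-arithmetic mean (`rationalScale_avg_le`).
* *Upper bound for the Bellman function.* Summed over the dyadic tree, the main inequality bounds
  the proportion of dyadic intervals on which the average of `f` is at least `y`; Lebesgue
  differentiation passes to `f` itself (`volume_real_ge_le`).
* *Lower bound.* Two test functions scaled by a common factor and placed on the two halves of the
  interval, one shifted down and the other up, form a new test function (`Attains.mean`). Following
  the recursion for `A` gives test functions for which the bound is attained at the values of `A` at
  dyadic points (`attains_bridgeSeq`), and continuity of `A` does the rest (`bellman_eq`).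
* *Jumps.* The function `x - x ^ 3 / 6` of `A` is concave, so its inverse is convex and `T` has
  one-sided derivatives on `(0, 1)`. At a dyadic point `t` let `D m` be the excess of `A t` over the
  mean `M` of the values at the neighbours `t ± 2 ^ (-(m + 1))`. The four-point inequality gives
  `D (m + 1) ≥ D m / 2`, strictness makes `D` positive from the second level on, and so the second
  difference of `A` at `t` is of the order of the step: the one-sided derivatives differ
  (`IsInnerDyadic.hasDerivJumpAt`).
-/

/-! ### The nonlinear mean -/

lemma nonlinearMean_comm (a b : ℝ) : nonlinearMean a b = nonlinearMean b a := by
  unfold nonlinearMean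
  rw [add_comm, show (a - b) ^ 2 = (b - a) ^ 2 by ring]

lemma sqrt_four_add_sq_pos (d : ℝ) : 0 < √(4 + d ^ 2) := Real.sqrt_pos.2 (by positivity)

lemma nonlinearMean_nonneg {a b : ℝ} (h : 0 ≤ a + b) : 0 ≤ nonlinearMean a b :=
  div_nonneg h (Real.sqrt_nonneg _)

lemma nonlinearMean_sq (a b : ℝ) :
    nonlinearMean a b ^ 2 = (a + b) ^ 2 / (4 + (a - b) ^ 2) := by
  unfold nonlinearMean
  rw [div_pow, Real.sq_sqrt (by positivity)]

lemma nonlinearMean_self (a : ℝ) : nonlinearMean a a = a := by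
  unfold nonlinearMean
  rw [sub_self, show (4 : ℝ) + 0 ^ 2 = 2 ^ 2 by norm_num, Real.sqrt_sq (by norm_num)]
  ring

/-- The order between two values of `M` is the order between the quantities
`(2 + a ^ 2 + b ^ 2) / (1 - a * b)`. -/
lemma nonlinearMean_le_of_mul_le {a b a' b' : ℝ} (h' : 0 ≤ a' + b')
    (h : (2 + a ^ 2 + b ^ 2) * (1 - a' * b') ≤ (2 + a' ^ 2 + b' ^ 2) * (1 - a * b)) :
    nonlinearMean a b ≤ nonlinearMean a' b' := by
  apply le_of_sq_le_sq _ (nonlinearMean_nonneg h')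
  rw [nonlinearMean_sq, nonlinearMean_sq, div_le_div_iff₀ (by positivity) (by positivity)]
  nlinarith

lemma nonlinearMean_lt_of_mul_lt {a b a' b' : ℝ} (h' : 0 ≤ a' + b')
    (h : (2 + a ^ 2 + b ^ 2) * (1 - a' * b') < (2 + a' ^ 2 + b' ^ 2) * (1 - a * b)) :
    nonlinearMean a b < nonlinearMean a' b' := by
  apply lt_of_pow_lt_pow_left₀ 2 (nonlinearMean_nonneg h')
  rw [nonlinearMean_sq, nonlinearMean_sq, div_lt_div_iff₀ (by positivity) (by positivity)]
  nlinarith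

lemma nonlinearMean_mono {a b a' b' : ℝ} (ha : 0 ≤ a) (hb : 0 ≤ b) (haa : a ≤ a') (hbb : b ≤ b')
    (ha' : a' ≤ 1) (hb' : b' ≤ 1) : nonlinearMean a b ≤ nonlinearMean a' b' := by
  apply nonlinearMean_le_of_mul_le (by linarith)
  have h1 : a * b ≤ a' * b' := mul_le_mul haa hbb hb (ha.trans haa)
  have h2 : a' * b' ≤ 1 := mul_le_one₀ ha' (hb.trans hbb) hb'
  have h3 : a ^ 2 ≤ a' ^ 2 := pow_le_pow_left₀ ha haa 2
  have h4 : b ^ 2 ≤ b' ^ 2 := pow_le_pow_left₀ hb hbb 2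
  exact mul_le_mul (by linarith) (by linarith) (by linarith) (by positivity)

lemma nonlinearMean_le_avg {a b : ℝ} (h : 0 ≤ a + b) : nonlinearMean a b ≤ (a + b) / 2 := by
  unfold nonlinearMean
  apply div_le_div_of_nonneg_left h (by norm_num)
  apply Real.le_sqrt_of_sq_le
  nlinarith [sq_nonneg (a - b)]

lemma le_nonlinearMean {a b : ℝ} (h : 0 ≤ a + b) :
    (a + b) / 2 * (1 - (b - a) ^ 2 / 8) ≤ nonlinearMean a b := by
  have h1 : √(4 + (a - b) ^ 2) ≤ 2 + (b - a) ^ 2 / 4 := by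
    apply Real.sqrt_le_iff.2 ⟨by positivity, ?_⟩
    nlinarith [sq_nonneg ((b - a) ^ 2)]
  have h2 : (a + b) / (2 + (b - a) ^ 2 / 4) ≤ nonlinearMean a b :=
    div_le_div_of_nonneg_left h (sqrt_four_add_sq_pos _) h1
  refine le_trans ?_ h2
  rw [le_div_iff₀ (by positivity)]
  nlinarith [mul_nonneg h (sq_nonneg ((b - a) ^ 2))]

/-- Replacing an end point of an interval by the mean shrinks the interval by a fixed factor. -/
lemma sub_nonlinearMean_le {a b : ℝ} (ha : 0 ≤ a) (hab : a ≤ b) (hb : b ≤ 1) :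
    b - nonlinearMean a b ≤ 5 / 8 * (b - a) := by
  have h := le_nonlinearMean (a := a) (b := b) (by linarith)
  have h1 : (a + b) / 2 * ((b - a) ^ 2 / 8) ≤ 1 * ((b - a) / 8) := by
    apply mul_le_mul (by linarith) _ (by positivity) (by norm_num)
    nlinarith
  nlinarith

lemma lt_nonlinearMean {a b : ℝ} (ha : 0 ≤ a) (hab : a < b) (hb : b ≤ 1) :
    a < nonlinearMean a b := by
  linarith [sub_nonlinearMean_le ha hab.le hb]

lemma nonlinearMean_lt {a b : ℝ} (ha : 0 ≤ a) (hab : a < b) :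
    nonlinearMean a b < b := by
  linarith [nonlinearMean_le_avg (a := a) (b := b) (by linarith)]

/-! ### The four-point inequality -/

section FourPoint

variable {u v w C k R R' : ℝ}

lemma sub_sqrt_ge (hv : 0 ≤ v) (hR : 0 < R)
    (hR2 : R ^ 2 = 1 + 2 * (v + w) + (v - w) ^ 2) :
    2 * v ≤ R * (R - (1 + w - v)) := by
  have h1 : 1 + w - v ≤ R := by
    apply le_of_sq_le_sq _ hR.le
    nlinarith
  have h2 : (R - (1 + w - v)) * (R + (1 + w - v)) = 4 * v := by nlinarith
  nlinarith [mul_nonneg (sub_nonneg.2 h1) (sub_nonneg.2 h1)]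

lemma sub_sqrt_gt (hv : 0 < v) (hR : 0 < R)
    (hR2 : R ^ 2 = 1 + 2 * (v + w) + (v - w) ^ 2) :
    2 * v < R * (R - (1 + w - v)) := by
  have h1 : 1 + w - v < R := by
    apply lt_of_pow_lt_pow_left₀ 2 hR.le
    nlinarith
  have h2 : (R - (1 + w - v)) * (R + (1 + w - v)) = 4 * v := by nlinarith
  nlinarith [mul_pos (sub_pos.2 h1) (sub_pos.2 h1)]

/-- With `R, R'` the square roots below, `R' - R` falls short of `u - w` by a definite amount. -/
lemma sqrt_gap (hv : 0 ≤ v) (hwu : w ≤ u) (hR : 0 < R) (hR' : 0 < R')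
    (hR2 : R ^ 2 = 1 + 2 * (v + w) + (v - w) ^ 2)
    (hR2' : R' ^ 2 = 1 + 2 * (v + u) + (v - u) ^ 2) :
    2 * v * (u - w) ≤ R * R' * ((u - w) - (R' - R)) := by
  have h1 := sub_sqrt_ge hv hR hR2
  have h2 := sub_sqrt_ge hv hR' hR2'
  have h3 : (R' - R) * (R + R') = (u - w) * (2 + u + w - 2 * v) := by nlinarith
  have h4 : (R + R') * (2 * v * (u - w)) ≤ (R + R') * (R * R' * ((u - w) - (R' - R))) := by
    have h5 : (R + R') * (R * R' * ((u - w) - (R' - R)))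
        = (u - w) * (R' * (R * (R - (1 + w - v))) + R * (R' * (R' - (1 + u - v)))) := by
      linear_combination (-(R * R')) * h3
    rw [h5]
    have := mul_le_mul_of_nonneg_left h1 hR'.le
    have := mul_le_mul_of_nonneg_left h2 hR.le
    nlinarith [mul_nonneg (sub_nonneg.2 hwu) hR.le]
  exact le_of_mul_le_mul_left h4 (by positivity)

lemma sqrt_gap_strict (hv : 0 < v) (hwu : w < u) (hR : 0 < R) (hR' : 0 < R')
    (hR2 : R ^ 2 = 1 + 2 * (v + w) + (v - w) ^ 2)
    (hR2' : R' ^ 2 = 1 + 2 * (v + u) + (v - u) ^ 2) :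
    2 * v * (u - w) < R * R' * ((u - w) - (R' - R)) := by
  have h1 := sub_sqrt_gt hv hR hR2
  have h2 := sub_sqrt_gt hv hR' hR2'
  have h3 : (R' - R) * (R + R') = (u - w) * (2 + u + w - 2 * v) := by nlinarith
  have h4 : (R + R') * (2 * v * (u - w)) < (R + R') * (R * R' * ((u - w) - (R' - R))) := by
    have h5 : (R + R') * (R * R' * ((u - w) - (R' - R)))
        = (u - w) * (R' * (R * (R - (1 + w - v))) + R * (R' * (R' - (1 + u - v)))) := by
      linear_combination (-(R * R')) * h3
    rw [h5]
    have h6 := mul_lt_mul_of_pos_left h1 hR'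
    have h7 := mul_lt_mul_of_pos_left h2 hR
    have h8 : (u - w) * (R' * (2 * v) + R * (2 * v)) <
        (u - w) * (R' * (R * (R - (1 + w - v))) + R * (R' * (R' - (1 + u - v)))) :=
      mul_lt_mul_of_pos_left (by linarith) (sub_pos.2 hwu)
    linarith
  exact lt_of_mul_lt_mul_left h4 (by positivity)

/-- The inequality between the parts of the two sides of `fourPoint_poly` that come from
`1 + v + w - R` and `1 + v + u - R'`. Both quantities are of order `v`. -/
lemma fourPoint_remainder (hv : 0 ≤ v) (hw : 0 ≤ w) (hwv : w ≤ v) (hvu : v ≤ u) (hu : u ≤ 1 / 4)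
    (huC : u ≤ C) (hC : C ≤ 1) (hR : 0 < R) (hR' : 0 < R')
    (hR2 : R ^ 2 = 1 + 2 * (v + w) + (v - w) ^ 2)
    (hR2' : R' ^ 2 = 1 + 2 * (v + u) + (v - u) ^ 2) :
    (1 + v + w - R) * R' * (C + u) * (R' - C + w) ≤
      (1 + v + u - R') * R * (C + w) * (R - C + u) := by
  have hgap := sqrt_gap hv (hwv.trans hvu) hR hR' hR2 hR2'
  have hd : R' - R ≤ u - w := by
    by_contra hcon
    have h1 : 0 < R * R' * ((R' - R) - (u - w)) := by
      apply mul_pos (by positivity); linarith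
    nlinarith [mul_nonneg hv (sub_nonneg.2 (hwv.trans hvu))]
  have hR1 : 1 + w ≤ R := by
    apply le_of_sq_le_sq _ hR.le
    nlinarith
  have hR1' : 1 + u ≤ R' := by
    apply le_of_sq_le_sq _ hR'.le
    nlinarith
  have hu0 : 0 ≤ u := hv.trans hvu
  set E := 1 + v + w with hE
  have hRE : R ≤ E := by
    apply le_of_sq_le_sq _ (by positivity)
    nlinarith [mul_nonneg hv hw]
  have hRE' : R' ≤ 1 + v + u := by
    apply le_of_sq_le_sq _ (by positivity)
    nlinarith [mul_nonneg hv (hw.trans (hwv.trans hvu))]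
  -- The two factors `R - C + u` are compared by `hd`, the others after rationalizing `E - R`.
  have key : (E - R) * R' * (C + u) ≤ (1 + v + u - R') * R * (C + w) := by
    have e1 : (E - R) * (E + R) = 4 * v * w := by rw [hE]; nlinarith
    have e2 : (1 + v + u - R') * (1 + v + u + R') = 4 * v * u := by nlinarith
    have hpoly : w * (C + u) * (R' * (1 + v + u + R')) ≤ u * (C + w) * (R * (E + R)) := by
      have h1 : R' * (1 + v + u + R') ≤ (R + (u - w)) * (E + R + 2 * (u - w)) := by
        apply mul_le_mul (by linarith) (by rw [hE]; linarith) (by positivity) (by linarith)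
      have h2 : w * (C + u) * (R' * (1 + v + u + R')) ≤
          w * (C + u) * ((R + (u - w)) * (E + R + 2 * (u - w))) :=
        mul_le_mul_of_nonneg_left h1 (by have := hu0.trans huC; positivity)
      refine h2.trans ?_
      have hδ : 0 ≤ u - w := by linarith
      have h3 : w * (C + u) * (E + 3 * R + 2 * (u - w)) ≤ C * (R * (E + R)) := by
        have h4 : w * (C + u) * (E + 3 * R + 2 * (u - w)) ≤
            C * (2 * w * (E + 3 * R + 2 * (u - w))) := by
          have : w * (C + u) ≤ C * (2 * w) := by nlinarith
          calc _ ≤ C * (2 * w) * (E + 3 * R + 2 * (u - w)) :=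
                mul_le_mul_of_nonneg_right this (by linarith)
            _ = _ := by ring
        refine h4.trans (mul_le_mul_of_nonneg_left ?_ (hu0.trans huC))
        have q1 : w * (E + 3 * R) ≤ 1 / 4 * (E + 3 * R) :=
          mul_le_mul_of_nonneg_right (by linarith) (by linarith)
        have q2 : w * (u - w) ≤ w * (1 / 4) := mul_le_mul_of_nonneg_left (by linarith) hw
        have q3 : R * (R - 1 / 2) ≤ E * (R - 1 / 2) :=
          mul_le_mul_of_nonneg_right hRE (by linarith)
        have q4 : 1 * w ≤ R * (R - 1) :=
          mul_le_mul (by linarith) (by linarith) hw hR.le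
        linarith
      have h5 := mul_le_mul_of_nonneg_left h3 hδ
      linarith
    have hEp : 0 < E + R := by positivity
    have hEp' : 0 < 1 + v + u + R' := by positivity
    have e3 : E - R = 4 * v * w / (E + R) := by rw [eq_div_iff hEp.ne']; exact e1
    have e4 : 1 + v + u - R' = 4 * v * u / (1 + v + u + R') := by
      rw [eq_div_iff hEp'.ne']; exact e2
    rw [e3, e4, div_mul_eq_mul_div, div_mul_eq_mul_div, div_mul_eq_mul_div, div_mul_eq_mul_div,
      div_le_div_iff₀ hEp hEp']
    calc 4 * v * w * R' * (C + u) * (1 + v + u + R')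
        = 4 * v * (w * (C + u) * (R' * (1 + v + u + R'))) := by ring
      _ ≤ 4 * v * (u * (C + w) * (R * (E + R))) :=
        mul_le_mul_of_nonneg_left hpoly (by positivity)
      _ = 4 * v * u * R * (C + w) * (E + R) := by ring
  have hnn : 0 ≤ (1 + v + u - R') * R * (C + w) :=
    mul_nonneg (mul_nonneg (by linarith) hR.le) (by linarith)
  calc _ ≤ (1 + v + u - R') * R * (C + w) * (R' - C + w) :=
        mul_le_mul_of_nonneg_right key (by linarith)
    _ ≤ _ := mul_le_mul_of_nonneg_left (by linarith) hnn

/-- The coefficient of the sign-indefinite term `k` in `fourPoint_poly` is at most `u - w`. -/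
lemma fourPoint_coeff_abs_le (hv : 0 ≤ v) (hw : 0 ≤ w) (hwv : w ≤ v) (hvu : v ≤ u) (hu : u ≤ 1 / 4)
    (huC : u ≤ C) (hC : C ≤ 1) (hR : 0 < R) (hR' : 0 < R')
    (hR2 : R ^ 2 = 1 + 2 * (v + w) + (v - w) ^ 2)
    (hR2' : R' ^ 2 = 1 + 2 * (v + u) + (v - u) ^ 2) :
    |R' * (R' - C + w) - R * (R - C + u)| ≤ u - w := by
  have hgap := sqrt_gap hv (hwv.trans hvu) hR hR' hR2 hR2'
  have hwu := hwv.trans hvu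
  have hd : R' - R ≤ u - w := by
    by_contra hcon
    have h1 : 0 < R * R' * ((R' - R) - (u - w)) := by
      apply mul_pos (by positivity); linarith
    nlinarith [mul_nonneg hv (sub_nonneg.2 hwu)]
  have hd0 : 0 ≤ R' - R := by
    have : R ≤ R' := by
      apply le_of_sq_le_sq _ hR'.le
      nlinarith
    linarith
  have hR1' : 1 + u ≤ R' := by
    apply le_of_sq_le_sq _ hR'.le
    nlinarith
  have hRE : R ≤ 1 + v + w := by
    apply le_of_sq_le_sq _ (by positivity)
    nlinarith [mul_nonneg hv hw]
  have e : R' * (R' - C + w) - R * (R - C + u)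
      = (u - w) * (2 + u + w - 2 * v - R) - (R' - R) * (C - w) := by
    linear_combination hR2' - hR2
  rw [e, abs_le]
  constructor
  · have h1 : (R' - R) * (C - w) ≤ (u - w) * 1 :=
      mul_le_mul hd (by linarith) (by linarith) (by linarith)
    have h2 : (u - w) * 0 ≤ (u - w) * (2 + u + w - 2 * v - R) :=
      mul_le_mul_of_nonneg_left (by linarith) (by linarith)
    linarith
  · have h1 : (R' - R) * (u - w) ≤ (R' - R) * (C - w) :=
      mul_le_mul_of_nonneg_left (by linarith) hd0
    have h2 : (u - w) * (2 + u + w - 2 * v - R) ≤ (u - w) * (1 + (R' - R)) :=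
      mul_le_mul_of_nonneg_left (by linarith) (by linarith)
    linarith

/-- The four-point inequality after elimination of `M`. The letters `u, v, w, C` stand for the
squares of the coordinates `D, e, f, c` of `fourPoint_reduce`, and `k` for `4 c D e f`. By
`sqrt_gap` the left-hand side is nonnegative. -/
lemma fourPoint_poly (hv : 0 ≤ v) (hw : 0 ≤ w) (hwv : w ≤ v) (hvu : v ≤ u) (hu : u ≤ 1 / 4)
    (huC : u ≤ C) (hC : C ≤ 1) (hk : |k| ≤ 4 * C * v) (hR : 0 < R) (hR' : 0 < R')
    (hR2 : R ^ 2 = 1 + 2 * (v + w) + (v - w) ^ 2)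
    (hR2' : R' ^ 2 = 1 + 2 * (v + u) + (v - u) ^ 2) :
    2 * C * (R * R' * ((u - w) - (R' - R)) - 2 * v * (u - w)) ≤
      (R' ^ 2 + (1 + v + u) * (C + w) + k) * (R * (R - C + u)) -
      (R ^ 2 + (1 + v + w) * (C + u) + k) * (R' * (R' - C + w)) := by
  have h1 := fourPoint_remainder hv hw hwv hvu hu huC hC hR hR' hR2 hR2'
  have h2 := fourPoint_coeff_abs_le hv hw hwv hvu hu huC hC hR hR' hR2 hR2'
  have h3 : k * (R' * (R' - C + w) - R * (R - C + u)) ≤ 4 * C * v * (u - w) := by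
    refine (le_abs_self _).trans ?_
    rw [abs_mul]
    exact mul_le_mul hk h2 (abs_nonneg _) ((abs_nonneg _).trans hk)
  linarith

end FourPoint

/-- The inner means `P, Q` of the four-point inequality enter the comparison
`nonlinearMean_le_of_mul_le` only through `P * Q` and `2 + P ^ 2 + Q ^ 2`. In the coordinates
`c, D, e, f` (the Walsh coefficients of the four points) both have the denominator `R`. The other
pairing of the points amounts to exchanging `D` and `f`. -/
lemma fourPoint_reduce {c D e f : ℝ} {R : ℝ}
    (hR : R = √(1 + (e + f) ^ 2) * √(1 + (e - f) ^ 2)) :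
    nonlinearMean (c - D - e - f) (c - D + e + f) * nonlinearMean (c + D - e + f) (c + D + e - f)
        = (c ^ 2 - D ^ 2) / R ∧
      2 + nonlinearMean (c - D - e - f) (c - D + e + f) ^ 2
          + nonlinearMean (c + D - e + f) (c + D + e - f) ^ 2
        = 2 * (R ^ 2 + (1 + e ^ 2 + f ^ 2) * (c ^ 2 + D ^ 2) + 4 * (c * D * e * f)) / R ^ 2 ∧
      0 < R ∧ R ^ 2 = 1 + 2 * (e ^ 2 + f ^ 2) + (e ^ 2 - f ^ 2) ^ 2 := by
  have hs : 0 < √(1 + (e + f) ^ 2) := Real.sqrt_pos.2 (by positivity)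
  have hr : 0 < √(1 + (e - f) ^ 2) := Real.sqrt_pos.2 (by positivity)
  have hR2 : R ^ 2 = (1 + (e + f) ^ 2) * (1 + (e - f) ^ 2) := by
    rw [hR, mul_pow, Real.sq_sqrt (by positivity), Real.sq_sqrt (by positivity)]
  have hRp : 0 < R := by rw [hR]; positivity
  refine ⟨?_, ?_, hRp, by rw [hR2]; ring⟩
  · unfold nonlinearMean
    rw [show 4 + (c - D - e - f - (c - D + e + f)) ^ 2 = 2 ^ 2 * (1 + (e + f) ^ 2) by ring,
      show 4 + (c + D - e + f - (c + D + e - f)) ^ 2 = 2 ^ 2 * (1 + (e - f) ^ 2) by ring,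
      Real.sqrt_mul (by norm_num), Real.sqrt_mul (by norm_num), Real.sqrt_sq (by norm_num), hR]
    field_simp
    ring
  · rw [nonlinearMean_sq, nonlinearMean_sq, hR2,
      show 4 + (c - D - e - f - (c - D + e + f)) ^ 2 = 4 * (1 + (e + f) ^ 2) by ring,
      show 4 + (c + D - e + f - (c + D + e - f)) ^ 2 = 4 * (1 + (e - f) ^ 2) by ring]
    have h1 : (1 + (e + f) ^ 2) ≠ 0 := by positivity
    have h2 : (1 + (e - f) ^ 2) ≠ 0 := by positivity
    field_simp
    ring

lemma two_mul_div_mul_one_sub {R S : ℝ} (hR : R ≠ 0) (hS : S ≠ 0) (x p q : ℝ) :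
    2 * x / R ^ 2 * (1 - (p - q) / S) = 2 / (R ^ 2 * S ^ 2) * (x * (S * (S - p + q))) := by
  field_simp
  ring

/-- The four-point inequality and its strict form, in Walsh coordinates. -/
lemma fourPoint_aux {c D e f : ℝ} (hfe : |f| ≤ e) (heD : e ≤ D) (ha : 0 ≤ c - D - e - f)
    (hb : c + D + e - f ≤ 1) :
    (nonlinearMean (nonlinearMean (c - D - e - f) (c - D + e + f))
        (nonlinearMean (c + D - e + f) (c + D + e - f)) ≤
      nonlinearMean (nonlinearMean (c - D - e - f) (c + D + e - f))
        (nonlinearMean (c - D + e + f) (c + D - e + f))) ∧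
    (|f| < D → 0 < e → nonlinearMean (nonlinearMean (c - D - e - f) (c - D + e + f))
        (nonlinearMean (c + D - e + f) (c + D + e - f)) <
      nonlinearMean (nonlinearMean (c - D - e - f) (c + D + e - f))
        (nonlinearMean (c - D + e + f) (c + D - e + f))) := by
  have he0 : 0 ≤ e := (abs_nonneg f).trans hfe
  have hD0 : 0 ≤ D := he0.trans heD
  obtain ⟨hf1, hf2⟩ := abs_le.1 hfe
  have hDc : D ≤ c := by linarith
  have hc0 : 0 ≤ c := hD0.trans hDc
  have hD2 : D ≤ 1 / 2 := by linarith
  obtain ⟨p1, s1, hR, hR2⟩ := fourPoint_reduce (D := D) (e := e) (c := c) (f := f) rfl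
  obtain ⟨p2, s2, hR', hR2'⟩ := fourPoint_reduce (D := f) (e := e) (c := c) (f := D) rfl
  set R := √(1 + (e + f) ^ 2) * √(1 + (e - f) ^ 2) with hRdef
  set R' := √(1 + (e + D) ^ 2) * √(1 + (e - D) ^ 2) with hRdef'
  rw [show c - f - e - D = c - D - e - f by ring, show c - f + e + D = c + D + e - f by ring,
    show c + f - e + D = c + D - e + f by ring, show c + f + e - D = c - D + e + f by ring,
    nonlinearMean_comm (c + D - e + f)] at p2 s2
  have hv : 0 ≤ e ^ 2 := sq_nonneg e
  have hw : 0 ≤ f ^ 2 := sq_nonneg f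
  have hwv : f ^ 2 ≤ e ^ 2 := sq_le_sq' hf1 hf2
  have hvu : e ^ 2 ≤ D ^ 2 := pow_le_pow_left₀ he0 heD 2
  have hu : D ^ 2 ≤ 1 / 4 := by nlinarith
  have huC : D ^ 2 ≤ c ^ 2 := pow_le_pow_left₀ hD0 hDc 2
  have hC : c ^ 2 ≤ 1 := by nlinarith
  have hk : |4 * (c * D * e * f)| ≤ 4 * c ^ 2 * e ^ 2 := by
    rw [show 4 * (c * D * e * f) = 4 * (c * D * e) * f by ring, abs_mul,
      abs_of_nonneg (by positivity : 0 ≤ 4 * (c * D * e))]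
    have h1 : c * D ≤ c * c := mul_le_mul_of_nonneg_left hDc hc0
    calc 4 * (c * D * e) * |f| ≤ 4 * (c * c * e) * e := by gcongr
      _ = _ := by ring
  have hmain := fourPoint_poly hv hw hwv hvu hu huC hC hk hR hR' hR2 hR2'
  have hgap := sqrt_gap hv (hwv.trans hvu) hR hR' hR2 hR2'
  have hsum : 0 ≤ nonlinearMean (c - D - e - f) (c + D + e - f) +
      nonlinearMean (c - D + e + f) (c + D - e + f) :=
    add_nonneg (nonlinearMean_nonneg (by linarith)) (nonlinearMean_nonneg (by linarith))
  have hpos : 0 < 2 / (R ^ 2 * R' ^ 2) := by positivity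
  constructor
  · apply nonlinearMean_le_of_mul_le hsum
    rw [p1, p2, s1, s2, two_mul_div_mul_one_sub hR.ne' hR'.ne',
      two_mul_div_mul_one_sub hR'.ne' hR.ne', mul_comm (R' ^ 2) (R ^ 2)]
    apply mul_le_mul_of_nonneg_left _ hpos.le
    have : 0 ≤ 2 * c ^ 2 * (R * R' * (D ^ 2 - f ^ 2 - (R' - R)) - 2 * e ^ 2 * (D ^ 2 - f ^ 2)) :=
      mul_nonneg (by positivity) (sub_nonneg.2 hgap)
    rw [show 4 * (c * f * e * D) = 4 * (c * D * e * f) by ring]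
    linarith only [this, hmain]
  · intro hfD he
    have hfD2 : f ^ 2 < D ^ 2 := sq_lt_sq' (by linarith [(abs_lt.1 hfD).1]) (abs_lt.1 hfD).2
    have hgap' := sqrt_gap_strict (by positivity) hfD2 hR hR' hR2 hR2'
    have hcp : 0 < c := by linarith
    apply nonlinearMean_lt_of_mul_lt hsum
    rw [p1, p2, s1, s2, two_mul_div_mul_one_sub hR.ne' hR'.ne',
      two_mul_div_mul_one_sub hR'.ne' hR.ne', mul_comm (R' ^ 2) (R ^ 2)]
    apply mul_lt_mul_of_pos_left _ hpos
    have : 0 < 2 * c ^ 2 * (R * R' * (D ^ 2 - f ^ 2 - (R' - R)) - 2 * e ^ 2 * (D ^ 2 - f ^ 2)) :=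
      mul_pos (by positivity) (sub_pos.2 hgap')
    rw [show 4 * (c * f * e * D) = 4 * (c * D * e * f) by ring]
    linarith only [this, hmain]

/-- The four-point inequality: pairing the extreme points and the middle points gives the greater
iterated mean. -/
lemma nonlinearMean_four_point {a₁ a₂ b₁ b₂ : ℝ} (h0 : 0 ≤ a₁) (h1 : a₁ ≤ a₂) (h2 : a₂ ≤ b₁)
    (h3 : b₁ ≤ b₂) (h4 : b₂ ≤ 1) :
    nonlinearMean (nonlinearMean a₁ a₂) (nonlinearMean b₁ b₂) ≤
      nonlinearMean (nonlinearMean a₁ b₂) (nonlinearMean a₂ b₁) := by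
  obtain ⟨c, D, e, f, rfl, rfl, rfl, rfl⟩ : ∃ c D e f : ℝ, a₁ = c - D - e - f ∧
      a₂ = c - D + e + f ∧ b₁ = c + D - e + f ∧ b₂ = c + D + e - f :=
    ⟨(a₁ + a₂ + b₁ + b₂) / 4, (b₁ + b₂ - a₁ - a₂) / 4, (a₂ - a₁ + b₂ - b₁) / 4,
      (a₂ - a₁ - b₂ + b₁) / 4, by ring, by ring, by ring, by ring⟩
  exact (fourPoint_aux (by rw [abs_le]; constructor <;> linarith) (by linarith) h0 h4).1

lemma nonlinearMean_four_point_strict {a m b : ℝ} (h0 : 0 ≤ a) (h1 : a < m) (h2 : m < b)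
    (h3 : b ≤ 1) :
    nonlinearMean (nonlinearMean a m) (nonlinearMean m b) <
      nonlinearMean (nonlinearMean a b) m := by
  have key := (fourPoint_aux (c := (a + m + m + b) / 4) (D := (m + b - a - m) / 4)
    (e := (m - a + b - m) / 4) (f := (m - a - b + m) / 4)
    (by rw [abs_le]; constructor <;> linarith) (by linarith) (by linarith) (by linarith)).2
    (by rw [abs_lt]; constructor <;> linarith) (by linarith)
  rw [show (a + m + m + b) / 4 - (m + b - a - m) / 4 - (m - a + b - m) / 4 - (m - a - b + m) / 4
      = a by ring,
    show (a + m + m + b) / 4 - (m + b - a - m) / 4 + (m - a + b - m) / 4 + (m - a - b + m) / 4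
      = m by ring,
    show (a + m + m + b) / 4 + (m + b - a - m) / 4 - (m - a + b - m) / 4 + (m - a - b + m) / 4
      = m by ring,
    show (a + m + m + b) / 4 + (m + b - a - m) / 4 + (m - a + b - m) / 4 - (m - a - b + m) / 4
      = b by ring, nonlinearMean_self] at key
  exact key

/-! ### Quasi-arithmetic means compared with the nonlinear mean -/

/-- A function `e` with `(e a + e b) / 2 ≤ e (M a b)` for `0 ≤ a + b`. -/
noncomputable def cubicScale (x : ℝ) : ℝ := x - x ^ 3 / 6

/-- A function `φ` with `(φ a + φ b) / 2 ≤ φ (M a b)` on `[1 / √5, 1]`. The constant `7 / 15` in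
`x ^ 2 / (x ^ 2 + 7 / 15)` is one for which both this and `barrier_poly` hold. -/
noncomputable def rationalScale (x : ℝ) : ℝ := 15 * x ^ 2 / (15 * x ^ 2 + 7)

lemma cubicScale_avg_le {a b : ℝ} (h : 0 ≤ a + b) :
    (cubicScale a + cubicScale b) / 2 ≤ cubicScale (nonlinearMean a b) := by
  unfold cubicScale nonlinearMean
  set q := √(4 + (a - b) ^ 2) with hq
  have hq2 : q ^ 2 = 4 + (a - b) ^ 2 := Real.sq_sqrt (by positivity)
  have hq0 : 0 < q := sqrt_four_add_sq_pos _
  have hqge : 2 ≤ q := by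
    apply le_of_sq_le_sq _ hq0.le
    nlinarith [sq_nonneg (a - b)]
  have e : (a + b) / q - ((a + b) / q) ^ 3 / 6 - (a - a ^ 3 / 6 + (b - b ^ 3 / 6)) / 2
      = (a + b) * ((q - 2) ^ 2 * (q + 4) / (16 * q)) +
        (a + b) ^ 3 * ((q - 2) * (q ^ 2 + 2 * q + 4) / (48 * q ^ 3)) := by
    field_simp
    linear_combination (-(a + b) * q ^ 3 * 576) * hq2
  have h1 : 0 ≤ (a + b) * ((q - 2) ^ 2 * (q + 4) / (16 * q)) := by positivity
  have h2 : 0 ≤ (a + b) ^ 3 * ((q - 2) * (q ^ 2 + 2 * q + 4) / (48 * q ^ 3)) := by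
    have : 0 ≤ q - 2 := by linarith
    positivity
  linarith

lemma rationalScale_avg_le {a b : ℝ} (ha0 : 0 ≤ a) (hb0 : 0 ≤ b) (ha : 1 ≤ 5 * a ^ 2)
    (hb : 1 ≤ 5 * b ^ 2) (ha1 : a ≤ 1) (hb1 : b ≤ 1) :
    (rationalScale a + rationalScale b) / 2 ≤ rationalScale (nonlinearMean a b) := by
  unfold rationalScale
  rw [nonlinearMean_sq]
  have hp1 : a * b ≤ 1 := mul_le_one₀ ha1 hb0 hb1
  have hp2 : 1 ≤ 5 * (a * b) := by
    have : 0 ≤ a * b := by positivity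
    nlinarith [mul_le_mul ha hb (by norm_num) (by positivity)]
  have e1 : 15 * ((a + b) ^ 2 / (4 + (a - b) ^ 2)) / (15 * ((a + b) ^ 2 / (4 + (a - b) ^ 2)) + 7)
      = 15 * (a + b) ^ 2 / (15 * (a + b) ^ 2 + 7 * (4 + (a - b) ^ 2)) := by
    have : 0 < 4 + (a - b) ^ 2 := by positivity
    field_simp
  rw [e1, div_add_div _ _ (by positivity) (by positivity), div_div,
    div_le_div_iff₀ (by positivity) (by positivity)]
  have hδ := sq_nonneg (a - b)
  have hy : 0 ≤ (15 * (a * b) - 3) * (35 - 15 * (a * b)) :=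
    mul_nonneg (by linarith) (by linarith)
  nlinarith [mul_nonneg hδ hy, mul_nonneg hδ hδ]

/-- The main inequality for the Chebyshev-Cantelli function. -/
lemma div_one_add_sq_mean_le {a b : ℝ} :
    nonlinearMean a b ^ 2 / (1 + nonlinearMean a b ^ 2) ≤
      (a ^ 2 / (1 + a ^ 2) + b ^ 2 / (1 + b ^ 2)) / 2 := by
  rw [nonlinearMean_sq]
  have e1 : (a + b) ^ 2 / (4 + (a - b) ^ 2) / (1 + (a + b) ^ 2 / (4 + (a - b) ^ 2))
      = (a + b) ^ 2 / (4 + (a - b) ^ 2 + (a + b) ^ 2) := by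
    have : 0 < 4 + (a - b) ^ 2 := by positivity
    field_simp
  rw [e1, div_add_div _ _ (by positivity) (by positivity), div_div,
    div_le_div_iff₀ (by positivity) (by positivity)]
  nlinarith [mul_nonneg (sq_nonneg (a - b)) (sq_nonneg (1 - a * b)), sq_nonneg ((a - b) * (a + b))]

/-- The polynomial inequality behind `rationalScale_chord`. -/
lemma barrier_poly {a c : ℝ} (ha0 : 0 ≤ a) (ha1 : a ≤ 1) (hc : 1 ≤ c) :
    22 * (c ^ 2 + 1) * (4 * a + (1 - a) * (c + 1 - a - a ^ 2)) ≤
      (c + 1) * (7 * (4 + (c - a) ^ 2) + 15 * (a + c) ^ 2) := by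
  obtain ⟨g, hg, rfl⟩ : ∃ g : ℝ, 0 ≤ g ∧ c = 1 + g := ⟨c - 1, by linarith, by ring⟩
  have e : (1 + g + 1) * (7 * (4 + (1 + g - a) ^ 2) + 15 * (a + (1 + g)) ^ 2) -
      22 * ((1 + g) ^ 2 + 1) * (4 * a + (1 - a) * ((1 + g) + 1 - a - a ^ 2))
      = (1 - a) * (12 + 44 * a ^ 2) + (6 + 4 * a + 44 * a * (1 - a ^ 2) + 22 * a ^ 2) * g
        + (16 * a + 22 * a * (1 - a ^ 2)) * g ^ 2 + 22 * a * g ^ 3 := by ring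
  have h1 : 0 ≤ 1 - a := by linarith
  have h2 : 0 ≤ 1 - a ^ 2 := by nlinarith
  have : 0 ≤ (1 - a) * (12 + 44 * a ^ 2) + (6 + 4 * a + 44 * a * (1 - a ^ 2) + 22 * a ^ 2) * g
        + (16 * a + 22 * a * (1 - a ^ 2)) * g ^ 2 + 22 * a * g ^ 3 := by positivity
  linarith

/-! ### The bridge on the dyadic grids -/

/-- `bridgeSeq n k` is the value of the suspension bridge at `k / 2 ^ (n + 1)` for `k ≤ 2 ^ n`
(and `1` for greater `k`). -/
noncomputable def bridgeSeq : ℕ → ℕ → ℝ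
  | 0, k => if k = 0 then 0 else 1
  | n + 1, k =>
      if k % 2 = 0 then bridgeSeq n (k / 2)
      else nonlinearMean (bridgeSeq n (k / 2)) (bridgeSeq n (k / 2 + 1))

lemma bridgeSeq_even (n k : ℕ) : bridgeSeq (n + 1) (2 * k) = bridgeSeq n k := by
  simp [bridgeSeq]

lemma bridgeSeq_odd (n k : ℕ) : bridgeSeq (n + 1) (2 * k + 1) =
    nonlinearMean (bridgeSeq n k) (bridgeSeq n (k + 1)) := by
  have h1 : (2 * k + 1) % 2 = 1 := by omega
  have h2 : (2 * k + 1) / 2 = k := by omega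
  simp [bridgeSeq, h1, h2]

lemma bridgeSeq_zero (n : ℕ) : bridgeSeq n 0 = 0 := by
  induction n with
  | zero => simp [bridgeSeq]
  | succ n ih => rw [← mul_zero 2, bridgeSeq_even, ih]

/-- The values lie in `[0, 1]` and increase, with increments at most `(5 / 8) ^ n`. -/
lemma bridgeSeq_bounds (n : ℕ) : ∀ k, 0 ≤ bridgeSeq n k ∧ bridgeSeq n k ≤ bridgeSeq n (k + 1) ∧
    bridgeSeq n (k + 1) ≤ 1 ∧ bridgeSeq n (k + 1) - bridgeSeq n k ≤ (5 / 8) ^ n := by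
  induction n with
  | zero =>
    intro k
    rcases k with _ | k <;> simp [bridgeSeq]
  | succ n ih =>
    intro k
    obtain ⟨j, rfl | rfl⟩ := Nat.even_or_odd' k
    · obtain ⟨h1, h2, h3, h4⟩ := ih j
      have h5 := sub_nonlinearMean_le h1 h2 h3
      have h6 := nonlinearMean_le_avg (a := bridgeSeq n j) (b := bridgeSeq n (j + 1)) (by linarith)
      rw [bridgeSeq_even, bridgeSeq_odd, pow_succ]
      exact ⟨h1, by linarith, by linarith, by linarith⟩
    · obtain ⟨h1, h2, h3, h4⟩ := ih j
      have h5 := sub_nonlinearMean_le h1 h2 h3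
      have h6 := nonlinearMean_le_avg (a := bridgeSeq n j) (b := bridgeSeq n (j + 1)) (by linarith)
      rw [show 2 * j + 1 + 1 = 2 * (j + 1) by ring, bridgeSeq_even, bridgeSeq_odd, pow_succ]
      exact ⟨by linarith, by linarith, by linarith, by linarith⟩

lemma bridgeSeq_nonneg (n k : ℕ) : 0 ≤ bridgeSeq n k := (bridgeSeq_bounds n k).1

lemma bridgeSeq_mono (n : ℕ) : Monotone (bridgeSeq n) :=
  monotone_nat_of_le_succ fun k => (bridgeSeq_bounds n k).2.1

lemma bridgeSeq_le_one (n k : ℕ) : bridgeSeq n k ≤ 1 :=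
  (bridgeSeq_bounds n k).2.1.trans (bridgeSeq_bounds n k).2.2.1

lemma bridgeSeq_pow (n : ℕ) : bridgeSeq n (2 ^ n) = 1 := by
  induction n with
  | zero => simp [bridgeSeq]
  | succ n ih => rw [pow_succ', bridgeSeq_even, ih]

lemma bridgeSeq_lt_succ (n : ℕ) : ∀ k < 2 ^ n, bridgeSeq n k < bridgeSeq n (k + 1) := by
  induction n with
  | zero =>
    intro k hk
    obtain rfl : k = 0 := by simpa using hk
    simp [bridgeSeq]
  | succ n ih =>
    intro k hk
    rw [pow_succ] at hk
    obtain ⟨j, rfl | rfl⟩ := Nat.even_or_odd' k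
    · rw [bridgeSeq_even, bridgeSeq_odd]
      exact lt_nonlinearMean (bridgeSeq_nonneg _ _) (ih j (by omega)) (bridgeSeq_le_one _ _)
    · rw [show 2 * j + 1 + 1 = 2 * (j + 1) by ring, bridgeSeq_even, bridgeSeq_odd]
      exact nonlinearMean_lt (bridgeSeq_nonneg _ _) (ih j (by omega))

lemma bridgeSeq_lift (n m k : ℕ) : bridgeSeq (n + m) (2 ^ m * k) = bridgeSeq n k := by
  induction m with
  | zero => simp
  | succ m ih => rw [pow_succ', mul_assoc, ← add_assoc, bridgeSeq_even, ih]

lemma bridgeSeq_three_point_even_odd {n : ℕ}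
    (ih : ∀ i j, nonlinearMean (bridgeSeq n i) (bridgeSeq n j) ≤ bridgeSeq (n + 1) (i + j))
    (p q : ℕ) : nonlinearMean (bridgeSeq (n + 1) (2 * p)) (bridgeSeq (n + 1) (2 * q + 1)) ≤
      bridgeSeq (n + 1 + 1) (2 * p + (2 * q + 1)) := by
  have hm := bridgeSeq_mono n
  rw [show 2 * p + (2 * q + 1) = 2 * (p + q) + 1 by ring, bridgeSeq_odd (n + 1), bridgeSeq_even,
    bridgeSeq_odd]
  have nn : ∀ i j, 0 ≤ nonlinearMean (bridgeSeq n i) (bridgeSeq n j) := fun i j =>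
    nonlinearMean_nonneg (add_nonneg (bridgeSeq_nonneg _ _) (bridgeSeq_nonneg _ _))
  rcases le_or_gt p q with h | h
  · have h4 := nonlinearMean_four_point (bridgeSeq_nonneg n p) le_rfl (hm h)
      (hm (Nat.le_succ q)) (bridgeSeq_le_one n (q + 1))
    rw [nonlinearMean_self,
      nonlinearMean_comm (nonlinearMean _ _) (nonlinearMean _ (bridgeSeq n q))] at h4
    exact h4.trans (nonlinearMean_mono (nn _ _) (nn _ _) (ih p q) (ih p (q + 1))
      (bridgeSeq_le_one _ _) (bridgeSeq_le_one _ _))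
  · have h4 := nonlinearMean_four_point (bridgeSeq_nonneg n q) (hm (Nat.le_succ q)) (hm h)
      le_rfl (bridgeSeq_le_one n p)
    rw [nonlinearMean_self] at h4
    rw [nonlinearMean_comm]
    refine h4.trans (nonlinearMean_mono (nn _ _) (nn _ _) ?_ ?_
      (bridgeSeq_le_one _ _) (bridgeSeq_le_one _ _))
    · rw [add_comm p]; exact ih q p
    · rw [show p + q + 1 = q + 1 + p by ring]; exact ih (q + 1) p

/-- The three-point inequality on the grids. The induction step uses the four-point inequality when
`i` or `j` is odd. -/
lemma bridgeSeq_three_point (n : ℕ) : ∀ i j,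
    nonlinearMean (bridgeSeq n i) (bridgeSeq n j) ≤ bridgeSeq (n + 1) (i + j) := by
  induction n with
  | zero =>
    intro i j
    rcases i with _ | i <;> rcases j with _ | j
    · simp [bridgeSeq, nonlinearMean_self]
    · have h := bridgeSeq_mono 1 (show 1 ≤ 0 + (j + 1) by omega)
      have h1 : bridgeSeq 1 1 = nonlinearMean 0 1 := by simp [bridgeSeq]
      rw [h1] at h
      simpa [bridgeSeq] using h
    · have h := bridgeSeq_mono 1 (show 1 ≤ (i + 1) + 0 by omega)
      have h1 : bridgeSeq 1 1 = nonlinearMean 0 1 := by simp [bridgeSeq]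
      rw [h1, nonlinearMean_comm] at h
      simpa [bridgeSeq] using h
    · have h := bridgeSeq_mono 1 (show 2 ≤ (i + 1) + (j + 1) by omega)
      have h1 : bridgeSeq 1 2 = 1 := bridgeSeq_pow 1
      rw [h1] at h
      simpa [bridgeSeq, nonlinearMean_self] using h
  | succ n ih =>
    have odd_odd : ∀ p q, p ≤ q →
        nonlinearMean (bridgeSeq (n + 1) (2 * p + 1)) (bridgeSeq (n + 1) (2 * q + 1)) ≤
          bridgeSeq (n + 1) (p + q + 1) := by
      intro p q hpq
      rcases hpq.eq_or_lt with rfl | hlt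
      · rw [nonlinearMean_self, ← two_mul]
      · have hm := bridgeSeq_mono n
        have h4 := nonlinearMean_four_point (bridgeSeq_nonneg n p) (hm (Nat.le_succ p)) (hm hlt)
          (hm (Nat.le_succ q)) (bridgeSeq_le_one n (q + 1))
        have nn : ∀ i j, 0 ≤ nonlinearMean (bridgeSeq n i) (bridgeSeq n j) := fun i j =>
          nonlinearMean_nonneg (add_nonneg (bridgeSeq_nonneg _ _) (bridgeSeq_nonneg _ _))
        rw [bridgeSeq_odd, bridgeSeq_odd]
        refine h4.trans ?_
        rw [← nonlinearMean_self (bridgeSeq (n + 1) (p + q + 1))]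
        refine nonlinearMean_mono (nn _ _) (nn _ _) (ih p (q + 1)) ?_
          (bridgeSeq_le_one _ _) (bridgeSeq_le_one _ _)
        rw [show p + q + 1 = p + 1 + q by ring]
        exact ih (p + 1) q
    intro i j
    obtain ⟨p, rfl | rfl⟩ := Nat.even_or_odd' i <;> obtain ⟨q, rfl | rfl⟩ := Nat.even_or_odd' j
    · rw [bridgeSeq_even, bridgeSeq_even, ← mul_add, bridgeSeq_even]
      exact ih p q
    · exact bridgeSeq_three_point_even_odd ih p q
    · rw [nonlinearMean_comm, add_comm (2 * p + 1)]
      exact bridgeSeq_three_point_even_odd ih q p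
    · rw [show 2 * p + 1 + (2 * q + 1) = 2 * (p + q + 1) by ring, bridgeSeq_even]
      rcases le_total p q with h | h
      · exact odd_odd p q h
      · rw [nonlinearMean_comm, add_comm p]
        exact odd_odd q p h

/-- Points of the grid `n + m` at distance less than `2 ^ (-(n + 1))` lie in two neighbouring cells
of the grid `n`. -/
lemma bridgeSeq_modulus (n m i j : ℕ) (hj : j < i + 2 ^ m) :
    bridgeSeq (n + m) j - bridgeSeq (n + m) i ≤ 2 * (5 / 8) ^ n := by
  set p := i / 2 ^ m
  have hpos : 0 < 2 ^ m := by positivity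
  have h1 : 2 ^ m * p ≤ i := Nat.mul_div_le i (2 ^ m)
  have h2 : i < 2 ^ m * (p + 1) := Nat.lt_mul_div_succ i hpos
  have h3 : j ≤ 2 ^ m * (p + 1 + 1) := by
    rw [mul_add (2 ^ m) (p + 1)]; omega
  have h4 := bridgeSeq_mono (n + m) h1
  have h5 := bridgeSeq_mono (n + m) h3
  rw [bridgeSeq_lift] at h4 h5
  have h6 := (bridgeSeq_bounds n p).2.2.2
  have h7 := (bridgeSeq_bounds n (p + 1)).2.2.2
  linarith

/-! ### The bridge as a function of a real variable -/

lemma div_mem_dyadicGrid {n k : ℕ} (hk : k ≤ 2 ^ n) : (k : ℝ) / 2 ^ (n + 1) ∈ dyadicGrid n :=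
  ⟨k, hk, rfl⟩

lemma div_mem_dyadicGrid_pred_iff {n k : ℕ} (hk : k ≤ 2 ^ (n + 1)) :
    (k : ℝ) / 2 ^ (n + 1 + 1) ∈ dyadicGrid n ↔ k % 2 = 0 := by
  constructor
  · rintro ⟨j, -, hj⟩
    have h : (k : ℝ) = ((2 * j : ℕ) : ℝ) := by
      push_cast
      rw [pow_succ, pow_succ] at hj
      field_simp at hj
      linarith
    have : k = 2 * j := by exact_mod_cast h
    omega
  · intro h
    refine ⟨k / 2, by rw [pow_succ] at hk; omega, ?_⟩
    have h2 : (k : ℝ) = 2 * ((k / 2 : ℕ) : ℝ) := by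
      have : k = 2 * (k / 2) := by omega
      exact_mod_cast this
    rw [h2]
    field_simp
    ring

lemma bridgeOnGrid_div (n : ℕ) : ∀ k : ℕ, k ≤ 2 ^ n →
    bridgeOnGrid n ((k : ℝ) / 2 ^ (n + 1)) = bridgeSeq n k := by
  induction n with
  | zero =>
    intro k hk
    by_cases h : k = 0
    · simp [bridgeOnGrid, bridgeSeq, h]
    · simp [bridgeOnGrid, bridgeSeq, h]
  | succ n ih =>
    intro k hk
    have hk' : k ≤ 2 * 2 ^ n := by rwa [pow_succ'] at hk
    unfold bridgeOnGrid
    rw [div_mem_dyadicGrid_pred_iff hk]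
    obtain ⟨j, rfl | rfl⟩ := Nat.even_or_odd' k
    · have e : ((2 * j : ℕ) : ℝ) / 2 ^ (n + 1 + 1) = (j : ℝ) / 2 ^ (n + 1) := by
        push_cast; field_simp; ring
      rw [if_pos (by omega), bridgeSeq_even, e, ih j (by omega)]
    · have e1 : ((2 * j + 1 : ℕ) : ℝ) / 2 ^ (n + 1 + 1) - 1 / 2 ^ (n + 2)
          = (j : ℝ) / 2 ^ (n + 1) := by
        push_cast; field_simp; ring
      have e2 : ((2 * j + 1 : ℕ) : ℝ) / 2 ^ (n + 1 + 1) + 1 / 2 ^ (n + 2)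
          = ((j + 1 : ℕ) : ℝ) / 2 ^ (n + 1) := by
        push_cast; field_simp; ring
      rw [if_neg (by omega), bridgeSeq_odd, e1, e2, ih j (by omega), ih (j + 1) (by omega)]

lemma dyadicGrid_mono : Monotone dyadicGrid := by
  refine monotone_nat_of_le_succ fun n => ?_
  rintro t ⟨k, hk, rfl⟩
  refine ⟨2 * k, by rw [pow_succ']; omega, ?_⟩
  push_cast; field_simp; ring

lemma bridgeOnGrid_add {n : ℕ} {t : ℝ} (ht : t ∈ dyadicGrid n) (m : ℕ) :
    bridgeOnGrid (n + m) t = bridgeOnGrid n t := by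
  induction m with
  | zero => rfl
  | succ m ih =>
    rw [← add_assoc, bridgeOnGrid, if_pos (dyadicGrid_mono (Nat.le_add_right n m) ht), ih]

lemma bridgeOnDyadics_div {n k : ℕ} (hk : k ≤ 2 ^ n) :
    bridgeOnDyadics ((k : ℝ) / 2 ^ (n + 1)) = bridgeSeq n k := by
  have hmem := div_mem_dyadicGrid hk
  have hne : {m : ℕ | (k : ℝ) / 2 ^ (n + 1) ∈ dyadicGrid m}.Nonempty := ⟨n, hmem⟩
  have hle : sInf {m : ℕ | (k : ℝ) / 2 ^ (n + 1) ∈ dyadicGrid m} ≤ n := Nat.sInf_le hmem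
  obtain ⟨m, hm⟩ := Nat.exists_eq_add_of_le hle
  unfold bridgeOnDyadics
  rw [← bridgeOnGrid_add (Nat.sInf_mem hne) m, ← hm, bridgeOnGrid_div n k hk]

/-- The greatest point of the `n`-th grid that is at most `x`. -/
noncomputable def dyadicFloor (n : ℕ) (x : ℝ) : ℝ := (⌊x * 2 ^ (n + 1)⌋₊ : ℝ) / 2 ^ (n + 1)

lemma floor_le_pow {x : ℝ} (hx : x ≤ 1 / 2) (n : ℕ) : ⌊x * 2 ^ (n + 1)⌋₊ ≤ 2 ^ n := by
  have : x * 2 ^ (n + 1) ≤ ((2 ^ n : ℕ) : ℝ) := by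
    push_cast
    rw [pow_succ]
    nlinarith [pow_pos (two_pos : (0 : ℝ) < 2) n]
  exact (Nat.floor_le_floor this).trans (Nat.floor_natCast _).le

lemma dyadicFloor_le {x : ℝ} (hx : 0 ≤ x) (n : ℕ) : dyadicFloor n x ≤ x := by
  unfold dyadicFloor
  rw [div_le_iff₀ (by positivity)]
  exact Nat.floor_le (by positivity)

lemma lt_dyadicFloor_add (x : ℝ) (n : ℕ) : x < dyadicFloor n x + 1 / 2 ^ (n + 1) := by
  unfold dyadicFloor
  rw [← add_div, lt_div_iff₀ (by positivity)]
  exact Nat.lt_floor_add_one _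

lemma tendsto_one_div_two_pow : Tendsto (fun n : ℕ => (1 : ℝ) / 2 ^ (n + 1)) atTop (𝓝 0) := by
  have h := (tendsto_pow_atTop_nhds_zero_of_lt_one (r := (1 / 2 : ℝ)) (by norm_num)
    (by norm_num)).comp (tendsto_add_atTop_nat 1)
  refine h.congr fun n => ?_
  simp

lemma tendsto_dyadicFloor {x : ℝ} (hx : 0 ≤ x) :
    Tendsto (fun n => dyadicFloor n x) atTop (𝓝 x) := by
  have h : Tendsto (fun n : ℕ => x - 1 / 2 ^ (n + 1)) atTop (𝓝 x) := by
    simpa using tendsto_const_nhds.sub tendsto_one_div_two_pow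
  exact tendsto_of_tendsto_of_tendsto_of_le_of_le h tendsto_const_nhds
    (fun n => by have := lt_dyadicFloor_add x n; simp only; linarith)
    (fun n => dyadicFloor_le hx n)

lemma dyadicFloor_nonneg (n : ℕ) (x : ℝ) : 0 ≤ dyadicFloor n x := by
  unfold dyadicFloor; positivity

lemma dyadicFloor_mem {x : ℝ} (hx : x ∈ Icc (0 : ℝ) (1 / 2)) (n : ℕ) :
    dyadicFloor n x ∈ Icc (0 : ℝ) (1 / 2) :=
  ⟨dyadicFloor_nonneg n x, (dyadicFloor_le hx.1 n).trans hx.2⟩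

lemma dyadicFloor_mem_dyadicPoints {x : ℝ} (hx : x ∈ Icc (0 : ℝ) (1 / 2)) (n : ℕ) :
    dyadicFloor n x ∈ dyadicPoints :=
  mem_iUnion.2 ⟨n, div_mem_dyadicGrid (floor_le_pow hx.2 n)⟩

lemma Icc_subset_closure_dyadicPoints : Icc (0 : ℝ) (1 / 2) ⊆ closure dyadicPoints := fun _ hx =>
  mem_closure_of_tendsto (tendsto_dyadicFloor hx.1)
    (Eventually.of_forall fun n => dyadicFloor_mem_dyadicPoints hx n)

lemma abs_bridgeOnDyadics_sub_le (n : ℕ) {s t : ℝ} (hs : s ∈ dyadicPoints) (ht : t ∈ dyadicPoints)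
    (hst : |s - t| < 1 / 2 ^ (n + 1)) :
    |bridgeOnDyadics s - bridgeOnDyadics t| ≤ 2 * (5 / 8) ^ n := by
  wlog hle : s ≤ t generalizing s t
  · rw [abs_sub_comm]
    exact this ht hs (by rwa [abs_sub_comm]) (le_of_not_ge hle)
  obtain ⟨a, ha⟩ := mem_iUnion.1 hs
  obtain ⟨b, hb⟩ := mem_iUnion.1 ht
  obtain ⟨i, hi, rfl⟩ := dyadicGrid_mono (show a ≤ n + (a + b) by omega) ha
  obtain ⟨j, hj, rfl⟩ := dyadicGrid_mono (show b ≤ n + (a + b) by omega) hb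
  set m := a + b
  have hp : (0 : ℝ) < 2 ^ (n + m + 1) := by positivity
  have hij : i ≤ j := by
    rw [div_le_div_iff_of_pos_right hp] at hle
    exact_mod_cast hle
  have hji : j < i + 2 ^ m := by
    rw [abs_sub_comm, ← sub_div, abs_of_nonneg
      (div_nonneg (by rw [sub_nonneg]; exact_mod_cast hij) hp.le), div_lt_iff₀ hp] at hst
    have e : 1 / 2 ^ (n + 1) * (2 : ℝ) ^ (n + m + 1) = 2 ^ m := by
      rw [show n + m + 1 = n + 1 + m by ring, pow_add 2 (n + 1) m]
      field_simp
    rw [e] at hst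
    have : (j : ℝ) < ((i + 2 ^ m : ℕ) : ℝ) := by push_cast; linarith
    exact_mod_cast this
  rw [bridgeOnDyadics_div hi, bridgeOnDyadics_div hj, abs_sub_comm,
    abs_of_nonneg (sub_nonneg.2 (bridgeSeq_mono _ hij))]
  exact bridgeSeq_modulus n m i j hji

lemma uniformContinuousOn_bridgeOnDyadics : UniformContinuousOn bridgeOnDyadics dyadicPoints := by
  rw [Metric.uniformContinuousOn_iff]
  intro ε hε
  obtain ⟨n, hn⟩ := exists_pow_lt_of_lt_one (show 0 < ε / 2 by positivity)
    (show (5 / 8 : ℝ) < 1 by norm_num)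
  refine ⟨1 / 2 ^ (n + 1), by positivity, fun s hs t ht hst => ?_⟩
  rw [Real.dist_eq] at hst ⊢
  have := abs_bridgeOnDyadics_sub_le n hs ht hst
  linarith

lemma exists_tendsto_bridgeOnDyadics {x : ℝ} (hx : x ∈ closure dyadicPoints) :
    ∃ y, Tendsto bridgeOnDyadics (𝓝[dyadicPoints] x) (𝓝 y) := by
  have : (𝓝[dyadicPoints] x).NeBot := mem_closure_iff_nhdsWithin_neBot.1 hx
  have hc : Cauchy (𝓝[dyadicPoints] x) := cauchy_nhds.mono nhdsWithin_le_nhds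
  exact cauchy_map_iff_exists_tendsto.1
    (hc.map_of_le uniformContinuousOn_bridgeOnDyadics inf_le_right)

lemma continuousOn_suspensionBridge : ContinuousOn suspensionBridge (Icc 0 (1 / 2)) :=
  continuousOn_extendFrom Icc_subset_closure_dyadicPoints fun _ hx =>
    exists_tendsto_bridgeOnDyadics (Icc_subset_closure_dyadicPoints hx)

lemma suspensionBridge_div {n k : ℕ} (hk : k ≤ 2 ^ n) :
    suspensionBridge ((k : ℝ) / 2 ^ (n + 1)) = bridgeSeq n k := by
  have hmem : (k : ℝ) / 2 ^ (n + 1) ∈ dyadicPoints := mem_iUnion.2 ⟨n, div_mem_dyadicGrid hk⟩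
  rw [← bridgeOnDyadics_div hk]
  exact extendFrom_eq (subset_closure hmem)
    (uniformContinuousOn_bridgeOnDyadics.continuousOn _ hmem)

lemma suspensionBridge_dyadicFloor {x : ℝ} (hx : x ≤ 1 / 2) (n : ℕ) :
    suspensionBridge (dyadicFloor n x) = bridgeSeq n ⌊x * 2 ^ (n + 1)⌋₊ :=
  suspensionBridge_div (floor_le_pow hx n)

lemma tendsto_suspensionBridge_dyadicFloor {x : ℝ} (hx : x ∈ Icc (0 : ℝ) (1 / 2)) :
    Tendsto (fun n => suspensionBridge (dyadicFloor n x)) atTop (𝓝 (suspensionBridge x)) :=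
  (continuousOn_suspensionBridge x hx).tendsto.comp
    (tendsto_nhdsWithin_iff.2 ⟨tendsto_dyadicFloor hx.1,
      Eventually.of_forall fun n => dyadicFloor_mem hx n⟩)

lemma suspensionBridge_zero : suspensionBridge 0 = 0 := by
  have := suspensionBridge_div (n := 0) (k := 0) (by norm_num)
  rw [bridgeSeq_zero] at this
  simpa using this

lemma suspensionBridge_half : suspensionBridge (1 / 2) = 1 := by
  have := suspensionBridge_div (n := 0) (k := 1) (by norm_num)
  simpa [bridgeSeq] using this

lemma monotoneOn_suspensionBridge : MonotoneOn suspensionBridge (Icc 0 (1 / 2)) := by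
  intro s hs t ht hst
  refine le_of_tendsto_of_tendsto' (tendsto_suspensionBridge_dyadicFloor hs)
    (tendsto_suspensionBridge_dyadicFloor ht) fun n => ?_
  rw [suspensionBridge_dyadicFloor hs.2, suspensionBridge_dyadicFloor ht.2]
  exact bridgeSeq_mono n (Nat.floor_le_floor (by gcongr))

lemma strictMonoOn_suspensionBridge : StrictMonoOn suspensionBridge (Icc 0 (1 / 2)) := by
  intro s hs t ht hst
  obtain ⟨n, hn⟩ := (tendsto_one_div_two_pow.eventually
    (gt_mem_nhds (show 0 < (t - s) / 2 by linarith))).exists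
  have hp : (0 : ℝ) < 2 ^ (n + 1) := by positivity
  -- `k / 2 ^ (n + 1)` and its right neighbour both lie in `[s, t]`.
  set k := ⌊s * 2 ^ (n + 1)⌋₊ + 1 with hk
  have e : (k : ℝ) / 2 ^ (n + 1) = dyadicFloor n s + 1 / 2 ^ (n + 1) := by
    rw [hk, dyadicFloor]; push_cast; ring
  have e' : ((k + 1 : ℕ) : ℝ) / 2 ^ (n + 1) = dyadicFloor n s + 2 * (1 / 2 ^ (n + 1)) := by
    rw [hk, dyadicFloor]; push_cast; ring
  have h1 := lt_dyadicFloor_add s n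
  have h2 := dyadicFloor_le hs.1 n
  have h3 : ((k + 1 : ℕ) : ℝ) / 2 ^ (n + 1) < t := by rw [e']; linarith
  have h4 : k + 1 ≤ 2 ^ n := by
    have h5 := h3.trans_le ht.2
    rw [div_lt_iff₀ hp, pow_succ, show (1 : ℝ) / 2 * (2 ^ n * 2) = ((2 ^ n : ℕ) : ℝ) by
      push_cast; ring] at h5
    exact (Nat.cast_lt.1 h5).le
  have mem : ∀ j : ℕ, j ≤ 2 ^ n → (j : ℝ) / 2 ^ (n + 1) ∈ Icc (0 : ℝ) (1 / 2) := by
    intro j hj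
    refine ⟨by positivity, ?_⟩
    rw [div_le_iff₀ hp, pow_succ, show (1 : ℝ) / 2 * (2 ^ n * 2) = ((2 ^ n : ℕ) : ℝ) by
      push_cast; ring]
    exact_mod_cast hj
  calc suspensionBridge s ≤ suspensionBridge ((k : ℝ) / 2 ^ (n + 1)) :=
        monotoneOn_suspensionBridge hs (mem k (by omega)) (by rw [e]; linarith)
    _ < suspensionBridge (((k + 1 : ℕ) : ℝ) / 2 ^ (n + 1)) := by
        rw [suspensionBridge_div (by omega), suspensionBridge_div h4]
        exact bridgeSeq_lt_succ n k (by omega)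
    _ ≤ suspensionBridge t := monotoneOn_suspensionBridge (mem _ h4) ht h3.le

lemma bijOn_suspensionBridge : BijOn suspensionBridge (Icc 0 (1 / 2)) (Icc 0 1) := by
  refine ⟨fun t ht => ⟨?_, ?_⟩, strictMonoOn_suspensionBridge.injOn, ?_⟩
  · rw [← suspensionBridge_zero]
    exact monotoneOn_suspensionBridge ⟨le_rfl, by norm_num⟩ ht ht.1
  · rw [← suspensionBridge_half]
    exact monotoneOn_suspensionBridge ht ⟨by norm_num, le_rfl⟩ ht.2
  · have := intermediate_value_Icc (show (0 : ℝ) ≤ 1 / 2 by norm_num) continuousOn_suspensionBridge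
    rwa [suspensionBridge_zero, suspensionBridge_half] at this

lemma suspensionBridge_nonneg {t : ℝ} (ht : t ∈ Icc (0 : ℝ) (1 / 2)) : 0 ≤ suspensionBridge t :=
  (bijOn_suspensionBridge.mapsTo ht).1

lemma suspensionBridge_le_one {t : ℝ} (ht : t ∈ Icc (0 : ℝ) (1 / 2)) : suspensionBridge t ≤ 1 :=
  (bijOn_suspensionBridge.mapsTo ht).2

lemma suspensionBridge_midpoint {n k : ℕ} (hk : k < 2 ^ n) {t : ℝ}
    (ht : t = (2 * (k : ℝ) + 1) / 2 ^ (n + 2)) :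
    suspensionBridge t = nonlinearMean (suspensionBridge (t - 1 / 2 ^ (n + 2)))
      (suspensionBridge (t + 1 / 2 ^ (n + 2))) := by
  have e0 : t = ((2 * k + 1 : ℕ) : ℝ) / 2 ^ (n + 1 + 1) := by rw [ht]; push_cast; ring
  have e1 : t - 1 / 2 ^ (n + 2) = (k : ℝ) / 2 ^ (n + 1) := by rw [ht]; field_simp; ring
  have e2 : t + 1 / 2 ^ (n + 2) = ((k + 1 : ℕ) : ℝ) / 2 ^ (n + 1) := by
    rw [ht]; push_cast; field_simp; ring
  rw [e1, e2, e0, suspensionBridge_div (by rw [pow_succ']; omega), suspensionBridge_div hk.le,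
    suspensionBridge_div hk, bridgeSeq_odd]

lemma continuous_nonlinearMean : Continuous fun p : ℝ × ℝ => nonlinearMean p.1 p.2 := by
  unfold nonlinearMean
  refine Continuous.div (by fun_prop) (by fun_prop) fun p => (sqrt_four_add_sq_pos _).ne'

/-- The three-point inequality, which is the main inequality for `bridgeInv` on `[0, 1]`. -/
lemma suspensionBridge_three_point {s t : ℝ} (hs : s ∈ Icc (0 : ℝ) (1 / 2))
    (ht : t ∈ Icc (0 : ℝ) (1 / 2)) :
    nonlinearMean (suspensionBridge s) (suspensionBridge t) ≤ suspensionBridge ((s + t) / 2) := by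
  have hmid : ∀ {x y : ℝ}, x ∈ Icc (0 : ℝ) (1 / 2) → y ∈ Icc (0 : ℝ) (1 / 2) →
      (x + y) / 2 ∈ Icc (0 : ℝ) (1 / 2) := fun hx hy =>
    ⟨by linarith [hx.1, hy.1], by linarith [hx.2, hy.2]⟩
  have h1 := (continuous_nonlinearMean.tendsto (suspensionBridge s, suspensionBridge t)).comp
    ((tendsto_suspensionBridge_dyadicFloor hs).prodMk_nhds
      (tendsto_suspensionBridge_dyadicFloor ht))
  have h2 : Tendsto (fun n => suspensionBridge ((dyadicFloor n s + dyadicFloor n t) / 2)) atTop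
      (𝓝 (suspensionBridge ((s + t) / 2))) :=
    (continuousOn_suspensionBridge _ (hmid hs ht)).tendsto.comp
      (tendsto_nhdsWithin_iff.2 ⟨((tendsto_dyadicFloor hs.1).add
        (tendsto_dyadicFloor ht.1)).div_const 2,
        Eventually.of_forall fun n => hmid (dyadicFloor_mem hs n) (dyadicFloor_mem ht n)⟩)
  refine le_of_tendsto_of_tendsto' h1 h2 fun n => ?_
  have e : (dyadicFloor n s + dyadicFloor n t) / 2 =
      ((⌊s * 2 ^ (n + 1)⌋₊ + ⌊t * 2 ^ (n + 1)⌋₊ : ℕ) : ℝ) / 2 ^ (n + 1 + 1) := by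
    unfold dyadicFloor; push_cast; field_simp; ring
  have hle : ⌊s * 2 ^ (n + 1)⌋₊ + ⌊t * 2 ^ (n + 1)⌋₊ ≤ 2 ^ (n + 1) := by
    exact (Nat.add_le_add (floor_le_pow hs.2 n) (floor_le_pow ht.2 n)).trans_eq (by ring)
  simp only [Function.comp]
  rw [e, suspensionBridge_div hle, suspensionBridge_dyadicFloor hs.2,
    suspensionBridge_dyadicFloor ht.2]
  exact bridgeSeq_three_point n _ _

lemma bridgeSeq_le_div (n : ℕ) : ∀ k, bridgeSeq n k ≤ k / 2 ^ n := by
  induction n with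
  | zero =>
    intro k
    rcases k with _ | k <;> simp [bridgeSeq]
  | succ n ih =>
    intro k
    obtain ⟨j, rfl | rfl⟩ := Nat.even_or_odd' k
    · rw [bridgeSeq_even]
      refine (ih j).trans_eq ?_
      push_cast; field_simp; ring
    · rw [bridgeSeq_odd]
      refine (nonlinearMean_le_avg (add_nonneg (bridgeSeq_nonneg _ _)
        (bridgeSeq_nonneg _ _))).trans ?_
      have h1 := ih j
      have h2 := ih (j + 1)
      have e : ((2 * j + 1 : ℕ) : ℝ) / 2 ^ (n + 1) =
          (j / 2 ^ n + ((j + 1 : ℕ) : ℝ) / 2 ^ n) / 2 := by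
        push_cast; field_simp; ring
      rw [e]
      linarith

lemma suspensionBridge_le_two_mul {t : ℝ} (ht : t ∈ Icc (0 : ℝ) (1 / 2)) :
    suspensionBridge t ≤ 2 * t := by
  refine le_of_tendsto_of_tendsto' (tendsto_suspensionBridge_dyadicFloor ht)
    ((tendsto_dyadicFloor ht.1).const_mul 2) fun n => ?_
  rw [suspensionBridge_dyadicFloor ht.2]
  refine (bridgeSeq_le_div n _).trans_eq ?_
  unfold dyadicFloor; field_simp; ring

/-! ### Concavity of the bridge in suitable scales -/

lemma nonneg_of_midpoint_concave {g : ℝ → ℝ} (hg : ContinuousOn g (Icc 0 1)) (h0 : 0 ≤ g 0)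
    (h1 : 0 ≤ g 1)
    (hmid : ∀ x ∈ Icc (0 : ℝ) 1, ∀ y ∈ Icc (0 : ℝ) 1, (g x + g y) / 2 ≤ g ((x + y) / 2))
    {x : ℝ} (hx : x ∈ Icc (0 : ℝ) 1) : 0 ≤ g x := by
  by_contra! hneg
  obtain ⟨z, hz, hzmin⟩ := isCompact_Icc.exists_isMinOn (nonempty_Icc.2 zero_le_one) hg
  have hzneg : g z < 0 := (hzmin hx).trans_lt hneg
  -- the leftmost minimum point
  set K := Icc (0 : ℝ) 1 ∩ g ⁻¹' {g z} with hK
  have hKc : IsClosed K := hg.preimage_isClosed_of_isClosed isClosed_Icc isClosed_singleton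
  have hKb : BddBelow K := ⟨0, fun y hy => hy.1.1⟩
  have hm : sInf K ∈ K := hKc.csInf_mem ⟨z, hz, rfl⟩ hKb
  set m := sInf K
  have hgm : g m = g z := hm.2
  have hm0 : 0 < m := by
    rcases hm.1.1.eq_or_lt with h | h
    · rw [← h] at hgm; linarith
    · exact h
  have hm1 : m < 1 := by
    rcases hm.1.2.eq_or_lt with h | h
    · rw [h] at hgm; linarith
    · exact h
  obtain ⟨d, hd, hd1, hd2⟩ : ∃ d : ℝ, 0 < d ∧ d ≤ m ∧ d ≤ 1 - m :=
    ⟨min m (1 - m), lt_min hm0 (by linarith), min_le_left _ _, min_le_right _ _⟩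
  have hl : m - d ∈ Icc (0 : ℝ) 1 := ⟨by linarith, by linarith⟩
  have hr : m + d ∈ Icc (0 : ℝ) 1 := ⟨by linarith, by linarith⟩
  have h2 := hmid _ hl _ hr
  rw [show (m - d + (m + d)) / 2 = m by ring] at h2
  have h3 : g z ≤ g (m + d) := hzmin hr
  have h4 : g z < g (m - d) := by
    refine lt_of_le_of_ne (hzmin hl) fun h => ?_
    have : m ≤ m - d := csInf_le hKb ⟨hl, h.symm⟩
    linarith
  linarith

lemma concaveOn_of_midpoint {f : ℝ → ℝ} {a b : ℝ} (hf : ContinuousOn f (Icc a b))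
    (hmid : ∀ x ∈ Icc a b, ∀ y ∈ Icc a b, (f x + f y) / 2 ≤ f ((x + y) / 2)) :
    ConcaveOn ℝ (Icc a b) f := by
  refine ⟨convex_Icc a b, fun x hx y hy p q hp hq hpq => ?_⟩
  set l : ℝ → ℝ := fun θ => (1 - θ) * x + θ * y with hl
  have hmem : ∀ θ ∈ Icc (0 : ℝ) 1, l θ ∈ Icc a b := fun θ hθ =>
    (convex_Icc a b) hx hy (by linarith [hθ.2] : 0 ≤ 1 - θ) hθ.1 (by ring)
  have key := nonneg_of_midpoint_concave
    (g := fun θ => f (l θ) - ((1 - θ) * f x + θ * f y)) ?_ ?_ ?_ ?_ (x := q)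
    ⟨hq, by linarith⟩
  · simp only [hl, show 1 - q = p by linarith] at key
    simpa using key
  · refine ContinuousOn.sub (hf.comp (by simp only [hl]; fun_prop) hmem) (by fun_prop)
  · simp [hl]
  · simp [hl]
  · intro s hs t ht
    have h := hmid _ (hmem s hs) _ (hmem t ht)
    have e : (l s + l t) / 2 = l ((s + t) / 2) := by simp only [hl]; ring
    rw [e] at h
    linarith

lemma continuous_cubicScale : Continuous cubicScale := by
  unfold cubicScale
  fun_prop

lemma continuous_rationalScale : Continuous rationalScale := by
  unfold rationalScale
  exact Continuous.div (by fun_prop) (by fun_prop) fun x => by positivity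

lemma cubicScale_strictMonoOn : StrictMonoOn cubicScale (Icc 0 1) := by
  intro x hx y hy hxy
  unfold cubicScale
  have h1 : x * x ≤ 1 := by nlinarith [hx.1, hx.2]
  have h2 : x * y ≤ 1 := by nlinarith [hx.1, hx.2, hy.1, hy.2]
  have h3 : y * y ≤ 1 := by nlinarith [hy.1, hy.2]
  have e : y - y ^ 3 / 6 - (x - x ^ 3 / 6) = (y - x) * (6 - (x * x + x * y + y * y)) / 6 := by ring
  have : 0 < (y - x) * (6 - (x * x + x * y + y * y)) / 6 :=
    div_pos (mul_pos (by linarith) (by linarith)) (by norm_num)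
  linarith

lemma rationalScale_le_iff {x y : ℝ} (hx : 0 ≤ x) (hy : 0 ≤ y) :
    rationalScale x ≤ rationalScale y ↔ x ≤ y := by
  unfold rationalScale
  rw [div_le_div_iff₀ (by positivity) (by positivity), ← sq_le_sq₀ hx hy]
  constructor <;> intro h <;> linarith

lemma mid_mem {a b x y : ℝ} (hx : x ∈ Icc a b) (hy : y ∈ Icc a b) : (x + y) / 2 ∈ Icc a b :=
  ⟨by linarith [hx.1, hy.1], by linarith [hx.2, hy.2]⟩

lemma concaveOn_cubicScale_bridge :
    ConcaveOn ℝ (Icc 0 (1 / 2)) (fun t => cubicScale (suspensionBridge t)) := by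
  refine concaveOn_of_midpoint ?_ fun s hs t ht => ?_
  · exact continuous_cubicScale.comp_continuousOn continuousOn_suspensionBridge
  · have hs0 := bijOn_suspensionBridge.mapsTo hs
    have ht0 := bijOn_suspensionBridge.mapsTo ht
    have h0 : 0 ≤ suspensionBridge s + suspensionBridge t := add_nonneg hs0.1 ht0.1
    refine (cubicScale_avg_le h0).trans (cubicScale_strictMonoOn.monotoneOn
      ⟨nonlinearMean_nonneg h0, ?_⟩ (bijOn_suspensionBridge.mapsTo (mid_mem hs ht))
      (suspensionBridge_three_point hs ht))
    exact (nonlinearMean_le_avg h0).trans (by linarith [hs0.2, ht0.2])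

/-- `A (1 / 4) = 1 / √5`, so `rationalScale_avg_le` applies to the values of the bridge on
`[1 / 4, 1 / 2]`. -/
lemma suspensionBridge_quarter_sq : suspensionBridge (1 / 4) ^ 2 = 1 / 5 := by
  have h := suspensionBridge_div (n := 1) (k := 1) (by norm_num)
  have h1 : bridgeSeq 1 1 = nonlinearMean 0 1 := by simp [bridgeSeq]
  rw [h1] at h
  rw [show (1 : ℝ) / 4 = ((1 : ℕ) : ℝ) / 2 ^ (1 + 1) by norm_num, h, nonlinearMean_sq]
  norm_num

lemma concaveOn_rationalScale_bridge :
    ConcaveOn ℝ (Icc (1 / 4) (1 / 2)) (fun t => rationalScale (suspensionBridge t)) := by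
  have hsub : Icc (1 / 4 : ℝ) (1 / 2) ⊆ Icc 0 (1 / 2) := Icc_subset_Icc (by norm_num) le_rfl
  refine concaveOn_of_midpoint ?_ fun s hs t ht => ?_
  · exact continuous_rationalScale.comp_continuousOn (continuousOn_suspensionBridge.mono hsub)
  · have hs0 := bijOn_suspensionBridge.mapsTo (hsub hs)
    have ht0 := bijOn_suspensionBridge.mapsTo (hsub ht)
    have h0 : 0 ≤ suspensionBridge s + suspensionBridge t := add_nonneg hs0.1 ht0.1
    have hge : ∀ r ∈ Icc (1 / 4 : ℝ) (1 / 2), 1 ≤ 5 * suspensionBridge r ^ 2 := by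
      intro r hr
      have q : (1 / 4 : ℝ) ∈ Icc (0 : ℝ) (1 / 2) := ⟨by norm_num, by norm_num⟩
      have := pow_le_pow_left₀ (suspensionBridge_nonneg q)
        (monotoneOn_suspensionBridge q (hsub hr) hr.1) 2
      rw [suspensionBridge_quarter_sq] at this
      linarith
    refine (rationalScale_avg_le hs0.1 ht0.1 (hge s hs) (hge t ht) hs0.2 ht0.2).trans ?_
    rw [rationalScale_le_iff (nonlinearMean_nonneg h0)
      (suspensionBridge_nonneg (mid_mem (hsub hs) (hsub ht)))]
    exact suspensionBridge_three_point (hsub hs) (hsub ht)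

/-! ### The mean of a value of the bridge and a number exceeding `1` -/

/-- In the rational scale, the passage from `M a 1` to `M a c` is at most the fraction
`(c ^ 2 - 1) / (c ^ 2 + 1) / (1 - a)` of the passage from `M a 1` to `1`. -/
lemma rationalScale_chord {a c : ℝ} (ha0 : 0 ≤ a) (ha1 : a < 1) (hc : 1 ≤ c) :
    (rationalScale (nonlinearMean a c) - rationalScale (nonlinearMean a 1)) * (1 - a) ≤
      ((c ^ 2 - 1) / (c ^ 2 + 1)) * (rationalScale 1 - rationalScale (nonlinearMean a 1)) := by
  have e : ∀ x : ℝ, rationalScale (nonlinearMean a x) =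
      15 * (a + x) ^ 2 / (15 * (a + x) ^ 2 + 7 * (4 + (x - a) ^ 2)) := by
    intro x
    unfold rationalScale
    rw [nonlinearMean_sq, show (a - x) ^ 2 = (x - a) ^ 2 by ring]
    have : 0 < 4 + (x - a) ^ 2 := by positivity
    field_simp
  have e1 : rationalScale 1 = 15 / 22 := by unfold rationalScale; norm_num
  rw [e, e, e1]
  set P := 15 * (a + c) ^ 2 + 7 * (4 + (c - a) ^ 2) with hP
  set Q := 15 * (a + 1) ^ 2 + 7 * (4 + (1 - a) ^ 2) with hQ
  have hP0 : 0 < P := by positivity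
  have hQ0 : 0 < Q := by positivity
  have hc2 : 0 < c ^ 2 + 1 := by positivity
  have d1 : 15 * (a + c) ^ 2 / P - 15 * (a + 1) ^ 2 / Q =
      420 * (c - 1) * (4 * a + (1 - a) * (c + 1 - a - a ^ 2)) / (P * Q) := by
    rw [div_sub_div _ _ hP0.ne' hQ0.ne', hP, hQ]
    congr 1
    ring
  have d2 : 15 / 22 - 15 * (a + 1) ^ 2 / Q = 420 * (1 - a) / (22 * Q) := by
    rw [div_sub_div _ _ (by norm_num) hQ0.ne', hQ]
    congr 1
    ring
  rw [d1, d2, div_mul_eq_mul_div, div_mul_div_comm, div_le_div_iff₀ (by positivity) (by positivity)]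
  have hpoly := barrier_poly ha0 ha1.le hc
  have h1 : 0 ≤ 420 * (c - 1) * (1 - a) * Q :=
    mul_nonneg (mul_nonneg (by linarith) (by linarith)) hQ0.le
  have h2 := mul_le_mul_of_nonneg_left hpoly h1
  rw [show (c + 1) * (7 * (4 + (c - a) ^ 2) + 15 * (a + c) ^ 2) = (c + 1) * P by
    rw [hP]; ring] at h2
  linarith

/-- The three-point inequality for a value of the bridge and a number `c > 1`, the latter placed
at the point `c ^ 2 / (1 + c ^ 2)`, to which the Chebyshev-Cantelli bound assigns it. -/
lemma bridge_ge_mean_of_gt_one {t c : ℝ} (ht : t ∈ Icc (0 : ℝ) (1 / 2)) (hc : 1 < c)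
    (hac : suspensionBridge t * c ≤ 1) (hmid : t + c ^ 2 / (1 + c ^ 2) < 1) :
    nonlinearMean (suspensionBridge t) c ≤ suspensionBridge ((t + c ^ 2 / (1 + c ^ 2)) / 2) := by
  set a := suspensionBridge t with ha
  have ha0 : 0 ≤ a := suspensionBridge_nonneg ht
  have ha1 : a < 1 := by nlinarith
  have hc2 : 0 < 1 + c ^ 2 := by positivity
  set s := c ^ 2 / (1 + c ^ 2) with hs
  have hs2 : 2 * s - 1 = (c ^ 2 - 1) / (c ^ 2 + 1) := by
    rw [hs]; field_simp; ring
  have hs0 : 1 / 2 < s := by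
    have : 0 < (c ^ 2 - 1) / (c ^ 2 + 1) := div_pos (by nlinarith) (by positivity)
    linarith
  have ht2 : t < 1 / 2 := by
    refine lt_of_le_of_ne ht.2 fun h => ?_
    rw [ha, h, suspensionBridge_half] at ha1
    exact lt_irrefl _ ha1
  have hhalf : (1 / 2 : ℝ) ∈ Icc (0 : ℝ) (1 / 2) := ⟨by norm_num, le_rfl⟩
  have hm0 : (t + 1 / 2) / 2 ∈ Icc (1 / 4 : ℝ) (1 / 2) := ⟨by linarith [ht.1], by linarith⟩
  have hm1 : (1 / 2 : ℝ) ∈ Icc (1 / 4 : ℝ) (1 / 2) := ⟨by norm_num, le_rfl⟩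
  have hmm : (t + s) / 2 ∈ Icc (0 : ℝ) (1 / 2) := ⟨by linarith [ht.1], by linarith⟩
  have hx0 : nonlinearMean a 1 ≤ suspensionBridge ((t + 1 / 2) / 2) := by
    have := suspensionBridge_three_point ht hhalf
    rwa [suspensionBridge_half] at this
  have hτ : 0 < 1 / 2 - t := by linarith
  -- the position of `(t + s) / 2` between `(t + 1 / 2) / 2` and `1 / 2`
  set q := (s - 1 / 2) / (1 / 2 - t) with hq
  have hq0 : 0 ≤ q := div_nonneg (by linarith) hτ.le
  have hq1 : q ≤ 1 := by rw [hq, div_le_one hτ]; linarith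
  have hconc := concaveOn_rationalScale_bridge.2 hm0 hm1 (by linarith : 0 ≤ 1 - q) hq0 (by ring)
  have e : (1 - q) • ((t + 1 / 2) / 2) + q • (1 / 2 : ℝ) = (t + s) / 2 := by
    have h : q * (1 / 2 - t) = s - 1 / 2 := by rw [hq, div_mul_cancel₀ _ hτ.ne']
    simp only [smul_eq_mul]
    linarith
  rw [e] at hconc
  simp only [smul_eq_mul, suspensionBridge_half] at hconc
  have hM1 : 0 ≤ nonlinearMean a 1 := nonlinearMean_nonneg (by linarith)
  have hM1' : nonlinearMean a 1 ≤ 1 := (nonlinearMean_le_avg (by linarith)).trans (by linarith)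
  have h1 : rationalScale (nonlinearMean a 1) ≤
      rationalScale (suspensionBridge ((t + 1 / 2) / 2)) :=
    (rationalScale_le_iff hM1 (hM1.trans hx0)).2 hx0
  have h2 : rationalScale (nonlinearMean a 1) ≤ rationalScale 1 :=
    (rationalScale_le_iff hM1 zero_le_one).2 hM1'
  have h3 := rationalScale_chord ha0 ha1 hc.le
  rw [← hs2] at h3
  have hqge : (2 * s - 1) / (1 - a) ≤ q := by
    have h2t : a ≤ 2 * t := suspensionBridge_le_two_mul ht
    rw [hq, div_le_div_iff₀ (by linarith) hτ]
    nlinarith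
  have h4 : rationalScale (nonlinearMean a c) - rationalScale (nonlinearMean a 1) ≤
      q * (rationalScale 1 - rationalScale (nonlinearMean a 1)) := by
    refine le_trans ?_ (mul_le_mul_of_nonneg_right hqge (sub_nonneg.2 h2))
    rw [div_mul_eq_mul_div, le_div_iff₀ (by linarith)]
    exact h3
  rw [← rationalScale_le_iff (nonlinearMean_nonneg (by linarith)) (suspensionBridge_nonneg hmm)]
  have h5 := mul_le_mul_of_nonneg_left h1 (sub_nonneg.2 hq1)
  linarith

/-! ### The inverse of the bridge and its main inequality -/

/-- The inverse of the suspension bridge, extended from `[0, 1]` to the line by `0` on the left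
and by the Chebyshev-Cantelli function `x ^ 2 / (1 + x ^ 2)` on the right. -/
noncomputable def bridgeInv (x : ℝ) : ℝ :=
  if x ≤ 0 then 0
  else if x ≤ 1 then Function.invFunOn suspensionBridge (Icc 0 (1 / 2)) x
  else x ^ 2 / (1 + x ^ 2)

lemma invFunOn_suspensionBridge_mem {x : ℝ} (hx : x ∈ Icc (0 : ℝ) 1) :
    Function.invFunOn suspensionBridge (Icc 0 (1 / 2)) x ∈ Icc (0 : ℝ) (1 / 2) :=
  Function.invFunOn_mem (bijOn_suspensionBridge.surjOn hx)

lemma suspensionBridge_invFunOn {x : ℝ} (hx : x ∈ Icc (0 : ℝ) 1) :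
    suspensionBridge (Function.invFunOn suspensionBridge (Icc 0 (1 / 2)) x) = x :=
  Function.invFunOn_eq (bijOn_suspensionBridge.surjOn hx)

lemma invFunOn_suspensionBridge_apply {t : ℝ} (ht : t ∈ Icc (0 : ℝ) (1 / 2)) :
    Function.invFunOn suspensionBridge (Icc 0 (1 / 2)) (suspensionBridge t) = t :=
  strictMonoOn_suspensionBridge.injOn
    (invFunOn_suspensionBridge_mem (bijOn_suspensionBridge.mapsTo ht)) ht
    (suspensionBridge_invFunOn (bijOn_suspensionBridge.mapsTo ht))

lemma bridgeInv_of_nonpos {x : ℝ} (hx : x ≤ 0) : bridgeInv x = 0 := if_pos hx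

lemma bridgeInv_of_mem {x : ℝ} (hx : x ∈ Icc (0 : ℝ) 1) :
    bridgeInv x = Function.invFunOn suspensionBridge (Icc 0 (1 / 2)) x := by
  unfold bridgeInv
  split_ifs with h1 h2
  · have hx0 : x = 0 := le_antisymm h1 hx.1
    have h := invFunOn_suspensionBridge_apply (t := 0) ⟨le_rfl, by norm_num⟩
    rw [suspensionBridge_zero] at h
    rw [hx0, h]
  · rfl
  · exact absurd hx.2 h2

lemma bridgeInv_of_one_lt {x : ℝ} (hx : 1 < x) : bridgeInv x = x ^ 2 / (1 + x ^ 2) := by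
  unfold bridgeInv
  rw [if_neg (by linarith), if_neg (by linarith)]

lemma bridgeInv_mem {x : ℝ} (hx : x ∈ Icc (0 : ℝ) 1) : bridgeInv x ∈ Icc (0 : ℝ) (1 / 2) := by
  rw [bridgeInv_of_mem hx]; exact invFunOn_suspensionBridge_mem hx

lemma suspensionBridge_bridgeInv {x : ℝ} (hx : x ∈ Icc (0 : ℝ) 1) :
    suspensionBridge (bridgeInv x) = x := by
  rw [bridgeInv_of_mem hx]; exact suspensionBridge_invFunOn hx

lemma bridgeInv_suspensionBridge {t : ℝ} (ht : t ∈ Icc (0 : ℝ) (1 / 2)) :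
    bridgeInv (suspensionBridge t) = t := by
  rw [bridgeInv_of_mem (bijOn_suspensionBridge.mapsTo ht)]
  exact invFunOn_suspensionBridge_apply ht

lemma bridgeInv_le_iff {x t : ℝ} (hx : x ∈ Icc (0 : ℝ) 1) (ht : t ∈ Icc (0 : ℝ) (1 / 2)) :
    bridgeInv x ≤ t ↔ x ≤ suspensionBridge t := by
  rw [← strictMonoOn_suspensionBridge.le_iff_le (bridgeInv_mem hx) ht,
    suspensionBridge_bridgeInv hx]

lemma le_bridgeInv_iff {x t : ℝ} (hx : x ∈ Icc (0 : ℝ) 1) (ht : t ∈ Icc (0 : ℝ) (1 / 2)) :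
    t ≤ bridgeInv x ↔ suspensionBridge t ≤ x := by
  rw [← strictMonoOn_suspensionBridge.le_iff_le ht (bridgeInv_mem hx),
    suspensionBridge_bridgeInv hx]

lemma strictMonoOn_bridgeInv : StrictMonoOn bridgeInv (Icc 0 1) := by
  intro x hx y hy hxy
  rw [← strictMonoOn_suspensionBridge.lt_iff_lt (bridgeInv_mem hx) (bridgeInv_mem hy),
    suspensionBridge_bridgeInv hx, suspensionBridge_bridgeInv hy]
  exact hxy

lemma bridgeInv_nonneg (x : ℝ) : 0 ≤ bridgeInv x := by
  rcases le_or_gt x 0 with h | h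
  · rw [bridgeInv_of_nonpos h]
  rcases le_or_gt x 1 with h1 | h1
  · exact (bridgeInv_mem ⟨h.le, h1⟩).1
  · rw [bridgeInv_of_one_lt h1]; positivity

lemma bridgeInv_le_one (x : ℝ) : bridgeInv x ≤ 1 := by
  rcases le_or_gt x 0 with h | h
  · rw [bridgeInv_of_nonpos h]; norm_num
  rcases le_or_gt x 1 with h1 | h1
  · exact (bridgeInv_mem ⟨h.le, h1⟩).2.trans (by norm_num)
  · rw [bridgeInv_of_one_lt h1, div_le_one (by positivity)]; linarith

lemma sq_div_le_bridgeInv {x : ℝ} (hx : 0 ≤ x) : x ^ 2 / (1 + x ^ 2) ≤ bridgeInv x := by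
  rcases le_or_gt x 1 with h1 | h1
  · have h2 := suspensionBridge_le_two_mul (bridgeInv_mem ⟨hx, h1⟩)
    rw [suspensionBridge_bridgeInv ⟨hx, h1⟩] at h2
    refine le_trans ?_ (show x / 2 ≤ bridgeInv x by linarith)
    rw [div_le_div_iff₀ (by positivity) (by positivity)]
    nlinarith [mul_nonneg hx (sq_nonneg (1 - x))]
  · rw [bridgeInv_of_one_lt h1]

lemma nonlinearMean_le_one {a b : ℝ} (h : a * b ≤ 1) : nonlinearMean a b ≤ 1 := by
  apply le_of_sq_le_sq _ zero_le_one
  rw [nonlinearMean_sq, div_le_iff₀ (by positivity)]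
  nlinarith

/-- The main inequality for arguments in `[0, ∞)` with a mean in `[0, 1]`, that is, with
`p * q ≤ 1`. -/
lemma bridgeInv_mean_le_aux {p q : ℝ} (hp : 0 ≤ p) (hpq : p ≤ q) (hm : p * q ≤ 1) :
    bridgeInv (nonlinearMean p q) ≤ (bridgeInv p + bridgeInv q) / 2 := by
  have hp1 : p ≤ 1 := by nlinarith
  have hM : nonlinearMean p q ∈ Icc (0 : ℝ) 1 :=
    ⟨nonlinearMean_nonneg (by linarith), nonlinearMean_le_one hm⟩
  have hpm : p ∈ Icc (0 : ℝ) 1 := ⟨hp, hp1⟩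
  rcases le_or_gt q 1 with hq | hq
  · have hqm : q ∈ Icc (0 : ℝ) 1 := ⟨hp.trans hpq, hq⟩
    have h := suspensionBridge_three_point (bridgeInv_mem hpm) (bridgeInv_mem hqm)
    rw [suspensionBridge_bridgeInv hpm, suspensionBridge_bridgeInv hqm] at h
    exact (bridgeInv_le_iff hM (mid_mem (bridgeInv_mem hpm) (bridgeInv_mem hqm))).2 h
  · rw [bridgeInv_of_one_lt hq]
    rcases le_or_gt 1 (bridgeInv p + q ^ 2 / (1 + q ^ 2)) with h1 | h1
    · exact (bridgeInv_mem hM).2.trans (by linarith)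
    · have h := bridge_ge_mean_of_gt_one (bridgeInv_mem hpm) hq
        (by rwa [suspensionBridge_bridgeInv hpm]) h1
      rw [suspensionBridge_bridgeInv hpm] at h
      refine (bridgeInv_le_iff hM ⟨?_, by linarith⟩).2 h
      have := (bridgeInv_mem hpm).1
      positivity

lemma bridgeInv_mean_le_of_le {p q : ℝ} (hpq : p ≤ q) :
    bridgeInv (nonlinearMean p q) ≤ (bridgeInv p + bridgeInv q) / 2 := by
  have hp0 := bridgeInv_nonneg p
  have hq0 := bridgeInv_nonneg q
  rcases le_or_gt (p + q) 0 with h | h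
  · have hM : nonlinearMean p q ≤ 0 := div_nonpos_of_nonpos_of_nonneg h (Real.sqrt_nonneg _)
    rw [bridgeInv_of_nonpos hM]
    positivity
  rcases le_or_gt 0 p with hp | hp
  · rcases le_or_gt (p * q) 1 with hm | hm
    · exact bridgeInv_mean_le_aux hp hpq hm
    · have h1 : 1 < nonlinearMean p q := by
        apply lt_of_pow_lt_pow_left₀ 2 (nonlinearMean_nonneg h.le)
        rw [nonlinearMean_sq, lt_div_iff₀ (by positivity)]
        nlinarith
      rw [bridgeInv_of_one_lt h1]
      refine div_one_add_sq_mean_le.trans ?_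
      have := sq_div_le_bridgeInv hp
      have := sq_div_le_bridgeInv (hp.trans hpq)
      linarith
  · -- decreasing `p` below `0` decreases the mean and does not change the right-hand side
    have hq : 0 < q := by linarith
    have h1 : nonlinearMean p q ≤ nonlinearMean 0 q := by
      have hd : q ≤ q - p := by linarith
      unfold nonlinearMean
      apply div_le_div₀ (by linarith) (by linarith) (sqrt_four_add_sq_pos _)
      apply Real.sqrt_le_sqrt
      nlinarith
    have h2 := bridgeInv_mean_le_aux le_rfl hq.le (by simp : (0 : ℝ) * q ≤ 1)
    have h3 : nonlinearMean 0 q ≤ 1 := nonlinearMean_le_one (by simp)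
    have h4 : 0 ≤ nonlinearMean p q := nonlinearMean_nonneg h.le
    rw [bridgeInv_of_nonpos le_rfl] at h2
    rw [bridgeInv_of_nonpos hp.le]
    exact (strictMonoOn_bridgeInv.monotoneOn ⟨h4, h1.trans h3⟩ ⟨h4.trans h1, h3⟩ h1).trans h2

/-- The main inequality. -/
lemma bridgeInv_mean_le (p q : ℝ) :
    bridgeInv (nonlinearMean p q) ≤ (bridgeInv p + bridgeInv q) / 2 := by
  rcases le_total p q with h | h
  · exact bridgeInv_mean_le_of_le h
  · rw [nonlinearMean_comm, add_comm]
    exact bridgeInv_mean_le_of_le h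

/-- The main inequality in the variables of the martingale: position `x`, remaining budget `l`,
jump `a`. -/
lemma bridgeInv_main {x l a : ℝ} (h : 0 < l - a ^ 2) :
    bridgeInv (x / √l) ≤
      (bridgeInv ((x + a) / √(l - a ^ 2)) + bridgeInv ((x - a) / √(l - a ^ 2))) / 2 := by
  have hs : 0 < √(l - a ^ 2) := Real.sqrt_pos.2 h
  have hs2 : √(l - a ^ 2) ^ 2 = l - a ^ 2 := Real.sq_sqrt h.le
  have hl : 0 < l := by nlinarith [sq_nonneg a]
  convert bridgeInv_mean_le ((x + a) / √(l - a ^ 2)) ((x - a) / √(l - a ^ 2)) using 2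
  set r := √(l - a ^ 2) with hr
  unfold nonlinearMean
  have e : 4 + ((x + a) / r - (x - a) / r) ^ 2 = (2 / r) ^ 2 * l := by
    rw [show l = r ^ 2 + a ^ 2 by rw [hs2]; ring]
    field_simp
    ring
  rw [e, Real.sqrt_mul (by positivity), Real.sqrt_sq (by positivity)]
  have : 0 < √l := Real.sqrt_pos.2 hl
  field_simp
  ring

/-! ### Dyadic averages -/

lemma dyadicInterval_eq_union (n k : ℕ) :
    dyadicInterval n k = dyadicInterval (n + 1) (2 * k) ∪ dyadicInterval (n + 1) (2 * k + 1) := by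
  unfold dyadicInterval
  have e1 : ((2 * k : ℕ) : ℝ) / 2 ^ (n + 1) = k / 2 ^ n := by push_cast; field_simp; ring
  have e2 : (((2 * k + 1 : ℕ) : ℝ) + 1) / 2 ^ (n + 1) = (k + 1) / 2 ^ n := by
    push_cast; field_simp; ring
  have e3 : (((2 * k : ℕ) : ℝ) + 1) / 2 ^ (n + 1) = ((2 * k + 1 : ℕ) : ℝ) / 2 ^ (n + 1) := by
    push_cast; ring
  rw [e3, e2, e1, Ico_union_Ico_eq_Ico]
  · rw [← e1]; gcongr; simp
  · rw [← e2]; gcongr; simp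

lemma dyadicInterval_disjoint (n k : ℕ) :
    Disjoint (dyadicInterval (n + 1) (2 * k)) (dyadicInterval (n + 1) (2 * k + 1)) := by
  unfold dyadicInterval
  rw [Set.disjoint_left]
  intro t h1 h2
  have e3 : (((2 * k : ℕ) : ℝ) + 1) / 2 ^ (n + 1) = ((2 * k + 1 : ℕ) : ℝ) / 2 ^ (n + 1) := by
    push_cast; ring
  rw [e3] at h1
  exact absurd h1.2 (not_lt.2 h2.1)

lemma measurableSet_dyadicInterval (n k : ℕ) : MeasurableSet (dyadicInterval n k) :=
  measurableSet_Ico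

lemma volume_dyadicInterval (n k : ℕ) :
    volume (dyadicInterval n k) = ENNReal.ofReal (1 / 2 ^ n) := by
  unfold dyadicInterval
  rw [Real.volume_Ico]
  congr 1
  ring

lemma volume_real_dyadicInterval (n k : ℕ) : volume.real (dyadicInterval n k) = 1 / 2 ^ n := by
  rw [Measure.real, volume_dyadicInterval, ENNReal.toReal_ofReal (by positivity)]

lemma dyadicInterval_subset_Ico {n k : ℕ} (hk : k < 2 ^ n) : dyadicInterval n k ⊆ Ico 0 1 := by
  have hk' : ((k : ℝ) + 1) / 2 ^ n ≤ 1 := by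
    rw [div_le_one (by positivity)]
    exact_mod_cast hk
  exact Ico_subset_Ico (by positivity) hk'

lemma mem_dyadicInterval_floor {t : ℝ} (ht : 0 ≤ t) (n : ℕ) :
    t ∈ dyadicInterval n ⌊t * 2 ^ n⌋₊ := by
  have hp : (0 : ℝ) < 2 ^ n := by positivity
  constructor
  · rw [div_le_iff₀ hp]
    exact Nat.floor_le (by positivity)
  · rw [lt_div_iff₀ hp]
    exact Nat.lt_floor_add_one _

lemma floor_lt_two_pow {t : ℝ} (ht : t ∈ Ico (0 : ℝ) 1) (n : ℕ) : ⌊t * 2 ^ n⌋₊ < 2 ^ n := by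
  rw [Nat.floor_lt (mul_nonneg ht.1 (by positivity))]
  push_cast
  nlinarith [ht.2, pow_pos (two_pos : (0 : ℝ) < 2) n]

/-- The average of `f` over a dyadic interval. -/
noncomputable def dyadicAvg (f : ℝ → ℝ) (n k : ℕ) : ℝ := 2 ^ n * ∫ t in dyadicInterval n k, f t

/-- The sum of the squares of the Haar coefficients of the dyadic intervals that strictly contain
`dyadicInterval n k`. -/
noncomputable def haarSqSum (f : ℝ → ℝ) : ℕ → ℕ → ℝ
  | 0, _ => 0
  | n + 1, k => haarSqSum f n (k / 2) + haarCoeff f n (k / 2) ^ 2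

lemma haarSqSum_even (f : ℝ → ℝ) (n k : ℕ) :
    haarSqSum f (n + 1) (2 * k) = haarSqSum f n k + haarCoeff f n k ^ 2 := by
  simp [haarSqSum]

lemma haarSqSum_odd (f : ℝ → ℝ) (n k : ℕ) :
    haarSqSum f (n + 1) (2 * k + 1) = haarSqSum f n k + haarCoeff f n k ^ 2 := by
  rw [haarSqSum, show (2 * k + 1) / 2 = k by omega]

lemma setIntegral_mul_haar {f : ℝ → ℝ} (hf : IntegrableOn f (Icc 0 1)) {n k : ℕ} (hk : k < 2 ^ n) :
    ∫ t in Icc (0 : ℝ) 1, f t * haar n k t =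
      (∫ t in dyadicInterval (n + 1) (2 * k + 1), f t) -
        ∫ t in dyadicInterval (n + 1) (2 * k), f t := by
  have hsub : ∀ j < 2 ^ (n + 1), dyadicInterval (n + 1) j ⊆ Icc 0 1 := fun j hj =>
    (dyadicInterval_subset_Ico hj).trans Ico_subset_Icc_self
  rw [pow_succ] at hsub
  have e : ∀ t, f t * haar n k t = (dyadicInterval (n + 1) (2 * k + 1)).indicator f t -
      (dyadicInterval (n + 1) (2 * k)).indicator f t := by
    intro t
    unfold haar
    rw [mul_sub, ← Set.indicator_mul_right, ← Set.indicator_mul_right]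
    simp
  simp_rw [e]
  rw [integral_sub (hf.indicator (measurableSet_dyadicInterval _ _))
    (hf.indicator (measurableSet_dyadicInterval _ _)),
    setIntegral_indicator (measurableSet_dyadicInterval _ _),
    setIntegral_indicator (measurableSet_dyadicInterval _ _),
    inter_eq_right.2 (hsub _ (by omega)), inter_eq_right.2 (hsub _ (by omega))]

lemma dyadicAvg_children {f : ℝ → ℝ} (hf : IntegrableOn f (Icc 0 1)) {n k : ℕ} (hk : k < 2 ^ n) :
    dyadicAvg f (n + 1) (2 * k) = dyadicAvg f n k - haarCoeff f n k ∧
      dyadicAvg f (n + 1) (2 * k + 1) = dyadicAvg f n k + haarCoeff f n k := by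
  have hsub : ∀ j < 2 ^ (n + 1), dyadicInterval (n + 1) j ⊆ Icc 0 1 := fun j hj =>
    (dyadicInterval_subset_Ico hj).trans Ico_subset_Icc_self
  rw [pow_succ] at hsub
  have hu := setIntegral_union (f := f) (μ := volume) (dyadicInterval_disjoint n k)
    (measurableSet_dyadicInterval _ _) (hf.mono_set (hsub _ (by omega)))
    (hf.mono_set (hsub _ (by omega)))
  rw [← dyadicInterval_eq_union] at hu
  unfold dyadicAvg haarCoeff
  rw [setIntegral_mul_haar hf hk, volume_real_dyadicInterval, hu, one_div, inv_inv, pow_succ]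
  constructor <;> ring

lemma dyadicAvg_zero {f : ℝ → ℝ} (hf : ∫ t in Icc (0 : ℝ) 1, f t = 0) : dyadicAvg f 0 0 = 0 := by
  unfold dyadicAvg dyadicInterval
  rw [integral_Icc_eq_integral_Ico] at hf
  simp [hf]

lemma dyadicInterval_subset_parent (n k : ℕ) :
    dyadicInterval (n + 1) k ⊆ dyadicInterval n (k / 2) := by
  rw [dyadicInterval_eq_union n]
  obtain ⟨j, rfl | rfl⟩ := Nat.even_or_odd' k
  · rw [show 2 * j / 2 = j by omega]; exact subset_union_left
  · rw [show (2 * j + 1) / 2 = j by omega]; exact subset_union_right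

lemma haarSqSum_nonneg (f : ℝ → ℝ) (n : ℕ) : ∀ k, 0 ≤ haarSqSum f n k := by
  induction n with
  | zero => intro k; exact le_rfl
  | succ n ih => intro k; exact add_nonneg (ih _) (sq_nonneg _)

lemma ofReal_haarSqSum_le (f : ℝ → ℝ) (n : ℕ) : ∀ k < 2 ^ n, ∀ t ∈ dyadicInterval n k,
    ENNReal.ofReal (haarSqSum f n k) ≤ ∑ m ∈ Finset.range n, ∑ k ∈ Finset.range (2 ^ m),
      (dyadicInterval m k).indicator (fun _ => ENNReal.ofReal (haarCoeff f m k ^ 2)) t := by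
  induction n with
  | zero => intro k _ t _; simp [haarSqSum]
  | succ n ih =>
    intro k hk t ht
    have hk2 : k / 2 < 2 ^ n := by rw [pow_succ] at hk; omega
    have ht2 := dyadicInterval_subset_parent n k ht
    rw [haarSqSum, ENNReal.ofReal_add (haarSqSum_nonneg _ _ _) (sq_nonneg _),
      Finset.sum_range_succ]
    refine add_le_add (ih _ hk2 t ht2) ?_
    refine le_trans (le_of_eq ?_) (Finset.single_le_sum (fun _ _ => zero_le)
      (Finset.mem_range.2 hk2))
    rw [indicator_of_mem ht2]

lemma haarSqSum_le_one {f : ℝ → ℝ} (hf : IsTestFunction f) {n k : ℕ} (hk : k < 2 ^ n) :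
    haarSqSum f n k ≤ 1 := by
  have hae : ∀ᵐ t ∂(volume.restrict (Icc (0 : ℝ) 1)), dyadicSquareFunction f t ≤ 1 := by
    filter_upwards [ENNReal.ae_le_essSup (μ := volume.restrict (Icc (0 : ℝ) 1))
      (dyadicSquareFunction f)] with t ht using ht.trans hf.square_le
  rw [ae_restrict_iff' measurableSet_Icc] at hae
  have hsub : dyadicInterval n k ⊆ Icc 0 1 :=
    (dyadicInterval_subset_Ico hk).trans Ico_subset_Icc_self
  obtain ⟨t, ht, htS⟩ : ∃ t ∈ dyadicInterval n k, dyadicSquareFunction f t ≤ 1 := by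
    by_contra! hcon
    have h0 : volume (dyadicInterval n k) ≤ 0 := by
      refine (measure_mono fun t ht => ?_).trans (le_of_eq hae)
      simp only [mem_compl_iff, mem_ofPred_eq, Classical.not_imp]
      exact ⟨hsub ht, not_le.2 (hcon t ht)⟩
    rw [volume_dyadicInterval] at h0
    have : (0 : ℝ) < 1 / 2 ^ n := by positivity
    exact absurd h0 (not_le.2 (ENNReal.ofReal_pos.2 this))
  have h1 := (ofReal_haarSqSum_le f n k hk t ht).trans (ENNReal.sum_le_tsum _)
  unfold dyadicSquareFunction at htS
  by_contra! hcon
  exact absurd htS (not_le.2 (ENNReal.one_lt_rpow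
    ((ENNReal.one_lt_ofReal.2 hcon).trans_le h1) (by norm_num)))

/-! ### The upper bound -/

lemma sum_range_two_mul (g : ℕ → ℝ) (N : ℕ) :
    ∑ k ∈ Finset.range (2 * N), g k = ∑ k ∈ Finset.range N, (g (2 * k) + g (2 * k + 1)) := by
  induction N with
  | zero => simp
  | succ N ih =>
    rw [show 2 * (N + 1) = 2 * N + 1 + 1 by ring, Finset.sum_range_succ, Finset.sum_range_succ, ih,
      Finset.sum_range_succ, add_assoc]

/-- The main inequality, summed over the dyadic tree: with a budget `l > 1` the remaining budget
stays positive along the martingale. -/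
lemma le_sum_bridgeInv {f : ℝ → ℝ} (hf : IsTestFunction f) {l : ℝ} (hl : 1 < l) (y : ℝ) (n : ℕ) :
    2 ^ n * bridgeInv (y / √l) ≤ ∑ k ∈ Finset.range (2 ^ n),
      bridgeInv ((y - dyadicAvg f n k) / √(l - haarSqSum f n k)) := by
  induction n with
  | zero => simp [dyadicAvg_zero hf.mean_zero, haarSqSum]
  | succ n ih =>
    rw [pow_succ', pow_succ', sum_range_two_mul, mul_assoc]
    refine (mul_le_mul_of_nonneg_left ih two_pos.le).trans ?_
    rw [Finset.mul_sum]
    refine Finset.sum_le_sum fun k hk => ?_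
    have hk' := Finset.mem_range.1 hk
    obtain ⟨h1, h2⟩ := dyadicAvg_children hf.integrable hk'
    have h3 : haarSqSum f (n + 1) (2 * k) ≤ 1 := haarSqSum_le_one hf (by rw [pow_succ]; omega)
    rw [haarSqSum_even] at h3
    rw [h1, h2, haarSqSum_even, haarSqSum_odd]
    have h4 := bridgeInv_main (x := y - dyadicAvg f n k) (l := l - haarSqSum f n k)
      (a := haarCoeff f n k) (by linarith)
    rw [show y - dyadicAvg f n k + haarCoeff f n k =
        y - (dyadicAvg f n k - haarCoeff f n k) by ring,
      show y - dyadicAvg f n k - haarCoeff f n k =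
        y - (dyadicAvg f n k + haarCoeff f n k) by ring, sub_sub] at h4
    linarith

/-- Where the average has reached `y`, the summand of `le_sum_bridgeInv` vanishes, and elsewhere it
is at most `1`. -/
lemma volume_dyadicAvg_ge_le {f : ℝ → ℝ} (hf : IsTestFunction f) {l : ℝ} (hl : 1 < l) (y : ℝ)
    (n : ℕ) : volume {t ∈ Ico (0 : ℝ) 1 | y ≤ dyadicAvg f n ⌊t * 2 ^ n⌋₊} ≤
      ENNReal.ofReal (1 - bridgeInv (y / √l)) := by
  classical
  set F := (Finset.range (2 ^ n)).filter fun k => y ≤ dyadicAvg f n k with hF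
  have hsub : {t ∈ Ico (0 : ℝ) 1 | y ≤ dyadicAvg f n ⌊t * 2 ^ n⌋₊} ⊆
      ⋃ k ∈ F, dyadicInterval n k := by
    rintro t ⟨ht, hy⟩
    exact mem_iUnion₂.2 ⟨_, Finset.mem_filter.2 ⟨Finset.mem_range.2 (floor_lt_two_pow ht n), hy⟩,
      mem_dyadicInterval_floor ht.1 n⟩
  refine (measure_mono hsub).trans ((measure_biUnion_finset_le _ _).trans ?_)
  simp_rw [volume_dyadicInterval]
  rw [Finset.sum_const, nsmul_eq_mul, ← ENNReal.ofReal_natCast,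
    ← ENNReal.ofReal_mul (by positivity)]
  apply ENNReal.ofReal_le_ofReal
  have h1 := le_sum_bridgeInv hf hl y n
  have h2 : ∑ k ∈ Finset.range (2 ^ n),
      bridgeInv ((y - dyadicAvg f n k) / √(l - haarSqSum f n k)) ≤
      ∑ k ∈ Finset.range (2 ^ n), (1 - if y ≤ dyadicAvg f n k then (1 : ℝ) else 0) := by
    refine Finset.sum_le_sum fun k _ => ?_
    split_ifs with h
    · rw [bridgeInv_of_nonpos (div_nonpos_of_nonpos_of_nonneg (by linarith) (Real.sqrt_nonneg _))]
      norm_num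
    · simpa using bridgeInv_le_one _
  rw [Finset.sum_sub_distrib, Finset.sum_boole] at h2
  simp only [Finset.sum_const, Finset.card_range, nsmul_eq_mul, mul_one] at h2
  push_cast at h2
  have h3 := h1.trans h2
  rw [mul_one_div, div_le_iff₀ (by positivity)]
  linarith

/-- Lebesgue differentiation along dyadic intervals. -/
lemma ae_tendsto_dyadicAvg {f : ℝ → ℝ} (hf : IntegrableOn f (Icc 0 1)) :
    ∀ᵐ t ∂(volume : Measure ℝ), t ∈ Ico (0 : ℝ) 1 →
      Tendsto (fun n : ℕ => dyadicAvg f n ⌊t * 2 ^ n⌋₊) atTop (𝓝 (f t)) := by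
  have hint : Integrable ((Icc (0 : ℝ) 1).indicator f) := hf.integrable_indicator measurableSet_Icc
  filter_upwards [IsUnifLocDoublingMeasure.ae_tendsto_average volume hint.locallyIntegrable 1]
    with t ht htm
  have hlim : Tendsto (fun n : ℕ => (1 : ℝ) / 2 ^ (n + 1)) atTop (𝓝[>] 0) :=
    tendsto_nhdsWithin_iff.2 ⟨tendsto_one_div_two_pow, Eventually.of_forall fun n => by
      simp only [mem_Ioi]; positivity⟩
  -- a dyadic interval is, up to its right endpoint, a ball around its centre
  have hball : ∀ n : ℕ, Metric.closedBall (((⌊t * 2 ^ n⌋₊ : ℝ) + 1 / 2) / 2 ^ n)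
      (1 / 2 ^ (n + 1)) = Icc ((⌊t * 2 ^ n⌋₊ : ℝ) / 2 ^ n) (((⌊t * 2 ^ n⌋₊ : ℝ) + 1) / 2 ^ n) := by
    intro n
    rw [Real.closedBall_eq_Icc]
    congr 1 <;> · field_simp; ring
  have h := ht (fun n : ℕ => ((⌊t * 2 ^ n⌋₊ : ℝ) + 1 / 2) / 2 ^ n) _ hlim
    (Eventually.of_forall fun n => by
      rw [one_mul, hball]
      exact Ico_subset_Icc_self (mem_dyadicInterval_floor htm.1 n))
  rw [indicator_of_mem (Ico_subset_Icc_self htm)] at h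
  refine h.congr fun n => ?_
  have hsub : dyadicInterval n ⌊t * 2 ^ n⌋₊ ⊆ Icc 0 1 :=
    (dyadicInterval_subset_Ico (floor_lt_two_pow htm n)).trans Ico_subset_Icc_self
  rw [hball, setAverage_eq, integral_Icc_eq_integral_Ico,
    setIntegral_indicator measurableSet_Icc]
  have e : volume.real (Icc ((⌊t * 2 ^ n⌋₊ : ℝ) / 2 ^ n) (((⌊t * 2 ^ n⌋₊ : ℝ) + 1) / 2 ^ n))
      = 1 / 2 ^ n := by
    rw [Real.volume_real_Icc, ← sub_div, add_sub_cancel_left, max_eq_left (by positivity)]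
  rw [e, show Ico ((⌊t * 2 ^ n⌋₊ : ℝ) / 2 ^ n) (((⌊t * 2 ^ n⌋₊ : ℝ) + 1) / 2 ^ n)
    = dyadicInterval n ⌊t * 2 ^ n⌋₊ from rfl, inter_eq_left.2 hsub]
  simp [dyadicAvg]

lemma volume_ge_le {f : ℝ → ℝ} (hf : IsTestFunction f) {l x y : ℝ} (hl : 1 < l) (hy : y < x) :
    volume {t ∈ Icc (0 : ℝ) 1 | x ≤ f t} ≤ ENNReal.ofReal (1 - bridgeInv (y / √l)) := by
  set E : ℕ → Set ℝ := fun N =>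
    ⋂ n ≥ N, {t ∈ Ico (0 : ℝ) 1 | y ≤ dyadicAvg f n ⌊t * 2 ^ n⌋₊} with hE
  have hmono : Monotone E := fun N M hNM => biInter_subset_biInter_left fun n hn => hNM.trans hn
  have hsub : {t ∈ Icc (0 : ℝ) 1 | x ≤ f t} ≤ᵐ[volume] ⋃ N, E N := by
    have h1 : ∀ᵐ t ∂(volume : Measure ℝ), t ≠ 1 := by simp [ae_iff]
    filter_upwards [ae_tendsto_dyadicAvg hf.integrable, h1] with t ht ht1 hmem
    obtain ⟨htI, hxt⟩ : t ∈ Icc (0 : ℝ) 1 ∧ x ≤ f t := hmem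
    have htI' : t ∈ Ico (0 : ℝ) 1 := ⟨htI.1, lt_of_le_of_ne htI.2 ht1⟩
    obtain ⟨N, hN⟩ := eventually_atTop.1 ((ht htI').eventually (lt_mem_nhds (hy.trans_le hxt)))
    exact mem_iUnion.2 ⟨N, mem_iInter₂.2 fun n hn => ⟨htI', (hN n hn).le⟩⟩
  refine (measure_mono_ae hsub).trans ?_
  rw [hmono.measure_iUnion]
  refine iSup_le fun N => ?_
  exact (measure_mono (biInter_subset_of_mem (le_refl N))).trans (volume_dyadicAvg_ge_le hf hl y N)

lemma volume_real_ge_le {f : ℝ → ℝ} (hf : IsTestFunction f) {x : ℝ} (hx : x ∈ Icc (0 : ℝ) 1) :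
    volume.real {t ∈ Icc (0 : ℝ) 1 | x ≤ f t} ≤ 1 - bridgeInv x := by
  have hle : ∀ {y l : ℝ}, 1 < l → y < x →
      volume.real {t ∈ Icc (0 : ℝ) 1 | x ≤ f t} ≤ 1 - bridgeInv (y / √l) := by
    intro y l hl hy
    have h := ENNReal.toReal_mono ENNReal.ofReal_ne_top (volume_ge_le hf hl hy)
    rwa [ENNReal.toReal_ofReal (by linarith [bridgeInv_le_one (y / √l)])] at h
  rcases hx.1.eq_or_lt with h0 | h0
  · have h := hle (y := -1) (l := 2) (by norm_num) (by linarith)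
    rw [bridgeInv_of_nonpos
      (div_nonpos_of_nonpos_of_nonneg (by norm_num) (Real.sqrt_nonneg _))] at h
    rw [← h0, bridgeInv_of_nonpos le_rfl]
    rwa [← h0] at h
  · by_contra! hcon
    -- pick `s` just below `bridgeInv x`, and `y`, `l` with `suspensionBridge s ≤ y / √l`
    obtain ⟨s, hs1, hs2⟩ := exists_between (max_lt (show 1 -
      volume.real {t ∈ Icc (0 : ℝ) 1 | x ≤ f t} < bridgeInv x by linarith)
      (show 0 < bridgeInv x from by
        rw [← bridgeInv_of_nonpos le_rfl]
        exact strictMonoOn_bridgeInv ⟨le_rfl, zero_le_one⟩ hx h0))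
    have hs1' := (le_max_left _ _).trans_lt hs1
    have hs0 := (le_max_right _ _).trans_lt hs1
    have hsI : s ∈ Icc (0 : ℝ) (1 / 2) := ⟨hs0.le, hs2.le.trans (bridgeInv_mem hx).2⟩
    have hsx : suspensionBridge s < x := by
      by_contra! h
      exact absurd ((bridgeInv_le_iff hx hsI).2 h) (not_le.2 hs2)
    have hs0' := suspensionBridge_nonneg hsI
    obtain ⟨y, hy1, hy2⟩ := exists_between hsx
    obtain ⟨l, hl1, hl2⟩ : ∃ l : ℝ, 1 < l ∧ suspensionBridge s ≤ y / √l := by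
      have hy0 : 0 < y := hs0'.trans_lt hy1
      rcases hs0'.eq_or_lt with h | h
      · exact ⟨2, by norm_num, by rw [← h]; positivity⟩
      · refine ⟨(y / suspensionBridge s) ^ 2, ?_, ?_⟩
        · have : 1 < y / suspensionBridge s := (one_lt_div h).2 hy1
          nlinarith
        · rw [Real.sqrt_sq (by positivity), div_div_cancel₀ hy0.ne']
    have hyl : y / √l ∈ Icc (0 : ℝ) 1 := by
      refine ⟨hs0'.trans hl2, (div_le_one (Real.sqrt_pos.2 (by linarith))).2 ?_⟩
      exact (hy2.le.trans hx.2).trans (Real.one_le_sqrt.2 hl1.le)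
    have h1 := (le_bridgeInv_iff hyl hsI).2 hl2
    linarith [hle hl1 hy2]

/-! ### Gluing test functions -/

/-- The square of the dyadic square function. -/
noncomputable def haarSq (f : ℝ → ℝ) (t : ℝ) : ℝ≥0∞ :=
  ∑' n : ℕ, ∑ k ∈ Finset.range (2 ^ n),
    (dyadicInterval n k).indicator (fun _ => ENNReal.ofReal (haarCoeff f n k ^ 2)) t

/-- Some `f` of mean zero whose square function is at most `√l` satisfies `μ {f ≥ x} ≥ p`. The
interval is `[0, 1)`, and the square function is bounded at each of its points, not only almost
everywhere. -/
def Attains (l x p : ℝ) : Prop :=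
  ∃ f : ℝ → ℝ, IntegrableOn f (Ico 0 1) ∧ ∫ t in Ico (0 : ℝ) 1, f t = 0 ∧
    (∀ t ∈ Ico (0 : ℝ) 1, haarSq f t ≤ ENNReal.ofReal l) ∧
    ENNReal.ofReal p ≤ volume {t ∈ Ico (0 : ℝ) 1 | x ≤ f t}

lemma Attains.mono {l l' x p : ℝ} (h : Attains l x p) (hl : l ≤ l') : Attains l' x p := by
  obtain ⟨f, h1, h2, h3, h4⟩ := h
  exact ⟨f, h1, h2, fun t ht => (h3 t ht).trans (ENNReal.ofReal_le_ofReal hl), h4⟩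

lemma haarSq_zero (t : ℝ) : haarSq (fun _ => 0) t = 0 := by
  simp [haarSq, haarCoeff]

lemma attains_zero_of_nonpos {x : ℝ} (hx : x ≤ 0) : Attains 0 x 1 :=
  ⟨fun _ => 0, integrableOn_zero, by simp, fun t _ => by simp [haarSq_zero], by
    rw [show {t ∈ Ico (0 : ℝ) 1 | x ≤ (fun _ => (0 : ℝ)) t} = Ico 0 1 from
      Set.ext fun t => ⟨fun h => h.1, fun h => ⟨h, hx⟩⟩]
    simp⟩

lemma attains_zero (x : ℝ) : Attains 0 x 0 :=
  ⟨fun _ => 0, integrableOn_zero, by simp, fun t _ => by simp [haarSq_zero], by simp⟩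

lemma haarCoeff_const_mul (r : ℝ) (f : ℝ → ℝ) (n k : ℕ) :
    haarCoeff (fun t => r * f t) n k = r * haarCoeff f n k := by
  unfold haarCoeff
  simp_rw [mul_assoc]
  rw [integral_const_mul]
  ring

lemma Attains.scale {l x p r : ℝ} (h : Attains l x p) (hr : 0 < r) :
    Attains (r ^ 2 * l) (r * x) p := by
  obtain ⟨f, h1, h2, h3, h4⟩ := h
  refine ⟨fun t => r * f t, h1.const_mul r, by rw [integral_const_mul, h2, mul_zero],
    fun t ht => ?_, h4.trans (measure_mono fun t ht =>
      ⟨ht.1, mul_le_mul_of_nonneg_left ht.2 hr.le⟩)⟩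
  have e : haarSq (fun t => r * f t) t = ENNReal.ofReal (r ^ 2) * haarSq f t := by
    unfold haarSq
    rw [← ENNReal.tsum_mul_left]
    congr 1; ext n
    rw [Finset.mul_sum]
    refine Finset.sum_congr rfl fun k _ => ?_
    rw [haarCoeff_const_mul, mul_pow, ENNReal.ofReal_mul (sq_nonneg r),
      ← Set.indicator_const_mul]
  rw [e, ENNReal.ofReal_mul (sq_nonneg r)]
  gcongr
  exact h3 t ht

lemma haarCoeff_eq_dyadicAvg {f : ℝ → ℝ} (hf : IntegrableOn f (Icc 0 1)) {n k : ℕ}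
    (hk : k < 2 ^ n) :
    haarCoeff f n k = (dyadicAvg f (n + 1) (2 * k + 1) - dyadicAvg f (n + 1) (2 * k)) / 2 := by
  obtain ⟨h1, h2⟩ := dyadicAvg_children hf hk
  rw [h1, h2]
  ring

/-- A substitution rule: averages of `f` agree, up to the constant `b`, with those of `g` on an
interval twice as long. -/
lemma dyadicAvg_of_comp {f g : ℝ → ℝ} {n i j : ℕ} {c b : ℝ}
    (hset : ∀ t, t ∈ dyadicInterval (n + 1) i ↔ 2 * t - c ∈ dyadicInterval n j)
    (hfg : ∀ t ∈ dyadicInterval (n + 1) i, f t = g (2 * t - c) + b)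
    (hg : IntegrableOn g (dyadicInterval n j)) :
    dyadicAvg f (n + 1) i = dyadicAvg g n j + b := by
  unfold dyadicAvg
  set G := (dyadicInterval n j).indicator (fun s => g s + b) with hG
  have e1 : ∫ t in dyadicInterval (n + 1) i, f t = ∫ t, G (2 * t - c) := by
    rw [← integral_indicator (measurableSet_dyadicInterval _ _)]
    congr 1; ext t
    by_cases ht : t ∈ dyadicInterval (n + 1) i
    · rw [indicator_of_mem ht, hG, indicator_of_mem ((hset t).1 ht), hfg t ht]
    · rw [indicator_of_notMem ht, hG, indicator_of_notMem (fun h => ht ((hset t).2 h))]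
  have e2 : ∫ t, G (2 * t - c) = 1 / 2 * ∫ s, G s := by
    rw [Measure.integral_comp_mul_left (fun s => G (s - c)) 2, integral_sub_right_eq_self]
    norm_num
  have e3 : ∫ s, G s = (∫ s in dyadicInterval n j, g s) + b * (1 / 2 ^ n) := by
    have hfin : volume (dyadicInterval n j) ≠ ∞ := by
      rw [volume_dyadicInterval]; exact ENNReal.ofReal_ne_top
    rw [hG, integral_indicator (measurableSet_dyadicInterval _ _),
      integral_add hg (integrableOn_const hfin), setIntegral_const, volume_real_dyadicInterval,
      smul_eq_mul, mul_comm b]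
  rw [e1, e2, e3, pow_succ]
  field_simp

/-- The function which is a copy of `g₁ - a` on the left half of the unit interval and a copy of
`g₂ + a` on the right half. -/
noncomputable def haarGlue (g₁ g₂ : ℝ → ℝ) (a t : ℝ) : ℝ :=
  (Ico (0 : ℝ) 1).indicator (fun s => g₁ s + -a) (2 * t) +
    (Ico (0 : ℝ) 1).indicator (fun s => g₂ s + a) (2 * t - 1)

section Glue

variable {g₁ g₂ : ℝ → ℝ} {a t : ℝ}

lemma glue_left (ht : 2 * t ∈ Ico (0 : ℝ) 1) : haarGlue g₁ g₂ a t = g₁ (2 * t) + -a := by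
  unfold haarGlue
  rw [indicator_of_mem ht, indicator_of_notMem (fun h => by linarith [h.1, ht.2]), add_zero]

lemma glue_right (ht : 2 * t - 1 ∈ Ico (0 : ℝ) 1) : haarGlue g₁ g₂ a t = g₂ (2 * t - 1) + a := by
  unfold haarGlue
  rw [indicator_of_mem ht, indicator_of_notMem (fun h => by linarith [h.2, ht.1]), zero_add]

lemma integrable_glue (h₁ : IntegrableOn g₁ (Ico 0 1)) (h₂ : IntegrableOn g₂ (Ico 0 1)) :
    Integrable (haarGlue g₁ g₂ a) := by
  have hc : ∀ b : ℝ, IntegrableOn (fun _ : ℝ => b) (Ico (0 : ℝ) 1) := fun b =>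
    integrableOn_const (by simp)
  have i1 : Integrable ((Ico (0 : ℝ) 1).indicator (fun s => g₁ s + -a)) :=
    (h₁.add (hc (-a))).integrable_indicator measurableSet_Ico
  have i2 : Integrable ((Ico (0 : ℝ) 1).indicator (fun s => g₂ s + a)) :=
    (h₂.add (hc a)).integrable_indicator measurableSet_Ico
  exact (i1.comp_mul_left' two_ne_zero).add
    ((i2.comp_sub_right 1).comp_mul_left' two_ne_zero)

lemma mem_dyadicInterval_succ_iff_left (n k : ℕ) (t : ℝ) :
    t ∈ dyadicInterval (n + 1) k ↔ 2 * t - 0 ∈ dyadicInterval n k := by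
  unfold dyadicInterval
  rw [mem_Ico, mem_Ico, pow_succ, div_le_iff₀ (by positivity), lt_div_iff₀ (by positivity),
    div_le_iff₀ (by positivity), lt_div_iff₀ (by positivity),
    show (2 * t - 0) * 2 ^ n = t * (2 ^ n * 2) by ring]

lemma mem_dyadicInterval_succ_iff_right (n k : ℕ) (t : ℝ) :
    t ∈ dyadicInterval (n + 1) (2 ^ n + k) ↔ 2 * t - 1 ∈ dyadicInterval n k := by
  unfold dyadicInterval
  rw [mem_Ico, mem_Ico, pow_succ, div_le_iff₀ (by positivity), lt_div_iff₀ (by positivity),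
    div_le_iff₀ (by positivity), lt_div_iff₀ (by positivity)]
  push_cast
  constructor <;> rintro ⟨h1, h2⟩ <;> constructor <;> linarith

lemma dyadicAvg_glue_left (h₁ : IntegrableOn g₁ (Ico 0 1)) {n k : ℕ} (hk : k < 2 ^ n) :
    dyadicAvg (haarGlue g₁ g₂ a) (n + 1) k = dyadicAvg g₁ n k + -a := by
  refine dyadicAvg_of_comp (mem_dyadicInterval_succ_iff_left n k) (fun t ht => ?_)
    (h₁.mono_set (dyadicInterval_subset_Ico hk))
  have h := dyadicInterval_subset_Ico hk ((mem_dyadicInterval_succ_iff_left n k t).1 ht)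
  rw [sub_zero] at h ⊢
  exact glue_left h

lemma dyadicAvg_glue_right (h₂ : IntegrableOn g₂ (Ico 0 1)) {n k : ℕ} (hk : k < 2 ^ n) :
    dyadicAvg (haarGlue g₁ g₂ a) (n + 1) (2 ^ n + k) = dyadicAvg g₂ n k + a :=
  dyadicAvg_of_comp (mem_dyadicInterval_succ_iff_right n k)
    (fun t ht => glue_right (dyadicInterval_subset_Ico hk
      ((mem_dyadicInterval_succ_iff_right n k t).1 ht)))
    (h₂.mono_set (dyadicInterval_subset_Ico hk))

lemma dyadicAvg_zero_zero (f : ℝ → ℝ) : dyadicAvg f 0 0 = ∫ t in Ico (0 : ℝ) 1, f t := by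
  simp [dyadicAvg, dyadicInterval]

lemma integrableOn_Icc_iff {f : ℝ → ℝ} : IntegrableOn f (Icc 0 1) ↔ IntegrableOn f (Ico 0 1) :=
  integrableOn_Icc_iff_integrableOn_Ico

lemma haarCoeff_glue_left (h₁ : IntegrableOn g₁ (Ico 0 1)) (h₂ : IntegrableOn g₂ (Ico 0 1))
    {n k : ℕ} (hk : k < 2 ^ n) :
    haarCoeff (haarGlue g₁ g₂ a) (n + 1) k = haarCoeff g₁ n k := by
  have hk' : 2 * k + 1 < 2 ^ (n + 1) := by rw [pow_succ]; omega
  rw [haarCoeff_eq_dyadicAvg (integrable_glue h₁ h₂).integrableOn (by omega),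
    haarCoeff_eq_dyadicAvg (integrableOn_Icc_iff.2 h₁) hk, dyadicAvg_glue_left h₁ hk',
    dyadicAvg_glue_left h₁ (by omega)]
  ring

lemma haarCoeff_glue_right (h₁ : IntegrableOn g₁ (Ico 0 1)) (h₂ : IntegrableOn g₂ (Ico 0 1))
    {n k : ℕ} (hk : k < 2 ^ n) :
    haarCoeff (haarGlue g₁ g₂ a) (n + 1) (2 ^ n + k) = haarCoeff g₂ n k := by
  have hk' : 2 * k + 1 < 2 ^ (n + 1) := by rw [pow_succ]; omega
  rw [haarCoeff_eq_dyadicAvg (integrable_glue h₁ h₂).integrableOn (by rw [pow_succ]; omega),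
    haarCoeff_eq_dyadicAvg (integrableOn_Icc_iff.2 h₂) hk,
    show 2 * (2 ^ n + k) + 1 = 2 ^ (n + 1) + (2 * k + 1) by ring,
    show 2 * (2 ^ n + k) = 2 ^ (n + 1) + 2 * k by ring,
    dyadicAvg_glue_right h₂ hk', dyadicAvg_glue_right h₂ (by omega)]
  ring

lemma haarCoeff_glue_zero (h₁ : IntegrableOn g₁ (Ico 0 1)) (h₂ : IntegrableOn g₂ (Ico 0 1))
    (z₁ : ∫ t in Ico (0 : ℝ) 1, g₁ t = 0) (z₂ : ∫ t in Ico (0 : ℝ) 1, g₂ t = 0) :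
    haarCoeff (haarGlue g₁ g₂ a) 0 0 = a ∧ ∫ t in Ico (0 : ℝ) 1, haarGlue g₁ g₂ a t = 0 := by
  have hi := (integrable_glue (a := a) h₁ h₂).integrableOn (s := Icc (0 : ℝ) 1)
  have e1 := dyadicAvg_glue_left (g₂ := g₂) (a := a) h₁ (n := 0) (k := 0) (by norm_num)
  have e2 := dyadicAvg_glue_right (g₁ := g₁) (a := a) h₂ (n := 0) (k := 0) (by norm_num)
  rw [dyadicAvg_zero_zero, z₁] at e1
  rw [dyadicAvg_zero_zero, z₂] at e2
  obtain ⟨c1, c2⟩ := dyadicAvg_children hi (n := 0) (k := 0) (by norm_num)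
  simp only [zero_add, mul_zero, pow_zero, add_zero] at e1 e2 c1 c2
  rw [dyadicAvg_zero_zero] at c1 c2
  constructor <;> linarith

lemma haarSq_glue (h₁ : IntegrableOn g₁ (Ico 0 1)) (h₂ : IntegrableOn g₂ (Ico 0 1))
    (z₁ : ∫ t in Ico (0 : ℝ) 1, g₁ t = 0) (z₂ : ∫ t in Ico (0 : ℝ) 1, g₂ t = 0)
    (ht : t ∈ Ico (0 : ℝ) 1) :
    haarSq (haarGlue g₁ g₂ a) t = ENNReal.ofReal (a ^ 2) +
      (if 2 * t < 1 then haarSq g₁ (2 * t) else haarSq g₂ (2 * t - 1)) := by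
  unfold haarSq
  rw [tsum_eq_zero_add' ENNReal.summable]
  congr 1
  · have : t ∈ dyadicInterval 0 0 := by simpa [dyadicInterval] using ht
    simp only [pow_zero, Finset.range_one, Finset.sum_singleton]
    rw [indicator_of_mem this, (haarCoeff_glue_zero h₁ h₂ z₁ z₂).1]
  · split_ifs with h
    · congr 1; ext n
      rw [show 2 ^ (n + 1) = 2 ^ n + 2 ^ n by ring, Finset.sum_range_add]
      have hz : ∑ x ∈ Finset.range (2 ^ n), (dyadicInterval (n + 1) (2 ^ n + x)).indicator
          (fun _ => ENNReal.ofReal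
            (haarCoeff (haarGlue g₁ g₂ a) (n + 1) (2 ^ n + x) ^ 2)) t = 0 := by
        refine Finset.sum_eq_zero fun k hk => indicator_of_notMem (fun hmem => ?_) _
        have := dyadicInterval_subset_Ico (Finset.mem_range.1 hk)
          ((mem_dyadicInterval_succ_iff_right n k t).1 hmem)
        linarith [this.1]
      rw [hz, add_zero]
      refine Finset.sum_congr rfl fun k hk => ?_
      rw [haarCoeff_glue_left h₁ h₂ (Finset.mem_range.1 hk)]
      have hiff := mem_dyadicInterval_succ_iff_left n k t
      rw [sub_zero] at hiff
      by_cases hm : t ∈ dyadicInterval (n + 1) k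
      · rw [indicator_of_mem hm, indicator_of_mem (hiff.1 hm)]
      · rw [indicator_of_notMem hm, indicator_of_notMem (fun h' => hm (hiff.2 h'))]
    · congr 1; ext n
      rw [show 2 ^ (n + 1) = 2 ^ n + 2 ^ n by ring, Finset.sum_range_add]
      have hz : ∑ x ∈ Finset.range (2 ^ n), (dyadicInterval (n + 1) x).indicator
          (fun _ => ENNReal.ofReal (haarCoeff (haarGlue g₁ g₂ a) (n + 1) x ^ 2)) t = 0 := by
        refine Finset.sum_eq_zero fun k hk => indicator_of_notMem (fun hmem => ?_) _
        have := dyadicInterval_subset_Ico (Finset.mem_range.1 hk)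
          ((mem_dyadicInterval_succ_iff_left n k t).1 hmem)
        linarith [this.2]
      rw [hz, zero_add]
      refine Finset.sum_congr rfl fun k hk => ?_
      rw [haarCoeff_glue_right h₁ h₂ (Finset.mem_range.1 hk)]
      have hiff := mem_dyadicInterval_succ_iff_right n k t
      by_cases hm : t ∈ dyadicInterval (n + 1) (2 ^ n + k)
      · rw [indicator_of_mem hm, indicator_of_mem (hiff.1 hm)]
      · rw [indicator_of_notMem hm, indicator_of_notMem (fun h' => hm (hiff.2 h'))]

end Glue

lemma volume_preimage_two_mul_sub (c : ℝ) (S : Set ℝ) :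
    volume ((fun t => 2 * t - c) ⁻¹' S) = ENNReal.ofReal (1 / 2) * volume S := by
  have : (fun t : ℝ => 2 * t - c) ⁻¹' S = (fun t => 2 * t) ⁻¹' ((fun s => s + -c) ⁻¹' S) := by
    ext t; simp [sub_eq_add_neg]
  rw [this, Real.volume_preimage_mul_left two_ne_zero, measure_preimage_add_right]
  norm_num

/-- Gluing with jump `a` spends `a ^ 2` of the budget and averages the measures. -/
lemma Attains.glue {l x a p₁ p₂ : ℝ} (hl : 0 ≤ l) (hp₁ : 0 ≤ p₁) (hp₂ : 0 ≤ p₂)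
    (h₁ : Attains l (x + a) p₁) (h₂ : Attains l (x - a) p₂) :
    Attains (l + a ^ 2) x ((p₁ + p₂) / 2) := by
  obtain ⟨g₁, i₁, z₁, s₁, v₁⟩ := h₁
  obtain ⟨g₂, i₂, z₂, s₂, v₂⟩ := h₂
  refine ⟨haarGlue g₁ g₂ a, (integrable_glue i₁ i₂).integrableOn,
    (haarCoeff_glue_zero i₁ i₂ z₁ z₂).2, fun t ht => ?_, ?_⟩
  · rw [haarSq_glue i₁ i₂ z₁ z₂ ht, add_comm l, ENNReal.ofReal_add (sq_nonneg a) hl]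
    gcongr
    split_ifs with h
    · exact s₁ _ ⟨by linarith [ht.1], h⟩
    · exact s₂ _ ⟨by linarith, by linarith [ht.2]⟩
  · set S := {t ∈ Ico (0 : ℝ) 1 | x ≤ haarGlue g₁ g₂ a t} with hS
    have hL : (fun t => 2 * t - 0) ⁻¹' {s ∈ Ico (0 : ℝ) 1 | x + a ≤ g₁ s} ⊆ S ∩ Iio (1 / 2) := by
      rintro t ⟨h1, h2⟩
      simp only [sub_zero] at h1 h2
      refine ⟨⟨⟨by linarith [h1.1], by linarith [h1.2]⟩, ?_⟩, ?_⟩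
      · rw [glue_left h1]; linarith
      · simp only [mem_Iio]; linarith [h1.2]
    have hR : (fun t => 2 * t - 1) ⁻¹' {s ∈ Ico (0 : ℝ) 1 | x - a ≤ g₂ s} ⊆ S \ Iio (1 / 2) := by
      rintro t ⟨h1, h2⟩
      refine ⟨⟨⟨by linarith [h1.1], by linarith [h1.2]⟩, ?_⟩, ?_⟩
      · rw [glue_right h1]; linarith
      · simp only [mem_Iio, not_lt]; linarith [h1.1]
    have hL' := measure_mono (μ := volume) hL
    have hR' := measure_mono (μ := volume) hR
    rw [volume_preimage_two_mul_sub] at hL' hR'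
    rw [← measure_inter_add_sdiff S measurableSet_Iio (t := Iio (1 / 2 : ℝ)),
      show (p₁ + p₂) / 2 = 1 / 2 * p₁ + 1 / 2 * p₂ by ring,
      ENNReal.ofReal_add (by positivity) (by positivity), ENNReal.ofReal_mul (by norm_num),
      ENNReal.ofReal_mul (by norm_num)]
    exact add_le_add ((mul_le_mul_right v₁ _).trans hL') ((mul_le_mul_right v₂ _).trans hR')

/-- With `q = √(4 + (u - v) ^ 2)`, both functions are scaled by `2 / q` and glued with the jump
`(u - v) / q`: the budgets `4 / q ^ 2` and `(u - v) ^ 2 / q ^ 2` add up to `1`. -/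
lemma Attains.mean {u v p₁ p₂ : ℝ} (hp₁ : 0 ≤ p₁) (hp₂ : 0 ≤ p₂) (h₁ : Attains 1 u p₁)
    (h₂ : Attains 1 v p₂) : Attains 1 (nonlinearMean u v) ((p₁ + p₂) / 2) := by
  have hq := sqrt_four_add_sq_pos (u - v)
  have hq2 : √(4 + (u - v) ^ 2) ^ 2 = 4 + (u - v) ^ 2 := Real.sq_sqrt (by positivity)
  set q := √(4 + (u - v) ^ 2) with hqdef
  have e1 : nonlinearMean u v + (u - v) / q = 2 / q * u := by
    unfold nonlinearMean; rw [← hqdef]; ring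
  have e2 : nonlinearMean u v - (u - v) / q = 2 / q * v := by
    unfold nonlinearMean; rw [← hqdef]; ring
  have key := Attains.glue (a := (u - v) / q) (x := nonlinearMean u v)
    (l := (2 / q) ^ 2 * 1) (by positivity) hp₁ hp₂
    (by rw [e1]; exact h₁.scale (div_pos two_pos hq))
    (by rw [e2]; exact h₂.scale (div_pos two_pos hq))
  refine key.mono (le_of_eq ?_)
  rw [div_pow, div_pow, hq2]
  have : 0 < 4 + (u - v) ^ 2 := by positivity
  field_simp
  ring

lemma one_sub_div_nonneg {n k : ℕ} (hk : k ≤ 2 ^ n) : 0 ≤ 1 - (k : ℝ) / 2 ^ (n + 1) := by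
  rw [sub_nonneg, div_le_one (by positivity)]
  have : (k : ℝ) ≤ 2 ^ n := by exact_mod_cast hk
  rw [pow_succ]
  nlinarith [pow_pos (two_pos : (0 : ℝ) < 2) n]

/-- Following the recursion of the bridge produces test functions which are optimal. -/
lemma attains_bridgeSeq (n : ℕ) : ∀ k ≤ 2 ^ n,
    Attains 1 (bridgeSeq n k) (1 - (k : ℝ) / 2 ^ (n + 1)) := by
  induction n with
  | zero =>
    intro k hk
    have hk' : k ≤ 1 := by simpa using hk
    interval_cases k
    · have h := (attains_zero_of_nonpos le_rfl).mono zero_le_one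
      simpa [bridgeSeq] using h
    · have h := Attains.glue (a := 1) (x := 1) le_rfl le_rfl zero_le_one (attains_zero _)
        (attains_zero_of_nonpos (by norm_num))
      norm_num at h
      convert h using 1 <;> norm_num [bridgeSeq]
  | succ n ih =>
    intro k hk
    have hk' : k ≤ 2 * 2 ^ n := by rwa [pow_succ'] at hk
    obtain ⟨j, rfl | rfl⟩ := Nat.even_or_odd' k
    · have h := ih j (by omega)
      rw [bridgeSeq_even]
      convert h using 2
      push_cast; field_simp; ring
    · have h := Attains.mean (one_sub_div_nonneg (show j ≤ 2 ^ n by omega))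
        (one_sub_div_nonneg (show j + 1 ≤ 2 ^ n by omega)) (ih j (by omega))
        (ih (j + 1) (by omega))
      rw [bridgeSeq_odd]
      convert h using 1
      push_cast; field_simp; ring

lemma Attains.exists_isTestFunction {x p : ℝ} (h : Attains 1 x p) :
    ∃ f, IsTestFunction f ∧ ENNReal.ofReal p ≤ volume {t ∈ Icc (0 : ℝ) 1 | x ≤ f t} := by
  obtain ⟨f, h1, h2, h3, h4⟩ := h
  refine ⟨f, ⟨integrableOn_Icc_iff.2 h1, by rwa [integral_Icc_eq_integral_Ico], ?_⟩,
    h4.trans (measure_mono fun t ht => ⟨Ico_subset_Icc_self ht.1, ht.2⟩)⟩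
  refine essSup_le_of_ae_le _ ?_
  rw [restrict_Ico_eq_restrict_Icc.symm]
  refine (ae_restrict_iff' measurableSet_Ico).2 (Eventually.of_forall fun t ht => ?_)
  have := h3 t ht
  rw [ENNReal.ofReal_one] at this
  exact ENNReal.rpow_le_one this (by norm_num)

/-! ### The Bellman function on `[0, 1]` -/

lemma bddAbove_bellman_set (x : ℝ) : BddAbove {m : ℝ | ∃ f : ℝ → ℝ, IsTestFunction f ∧
    m = volume.real {t ∈ Icc (0 : ℝ) 1 | x ≤ f t}} := by
  refine ⟨1, ?_⟩
  rintro m ⟨f, -, rfl⟩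
  refine (measureReal_mono (s₂ := Icc (0 : ℝ) 1) (fun t ht => ht.1) (by simp)).trans ?_
  simp

lemma le_bellman {x t : ℝ} (ht : t ∈ dyadicPoints) (hx : x ≤ suspensionBridge t) :
    1 - t ≤ bellman x := by
  obtain ⟨n, hn⟩ := mem_iUnion.1 ht
  obtain ⟨k, hk, rfl⟩ := hn
  rw [suspensionBridge_div hk] at hx
  obtain ⟨f, hf, hv⟩ := (attains_bridgeSeq n k hk).exists_isTestFunction
  refine le_trans ?_ (le_csSup (bddAbove_bellman_set x) ⟨f, hf, rfl⟩)
  have hfin : volume {t ∈ Icc (0 : ℝ) 1 | x ≤ f t} ≠ ∞ :=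
    ((measure_mono fun t ht => ht.1).trans_lt (by simp : volume (Icc (0 : ℝ) 1) < ∞)).ne
  rw [Measure.real, ← ENNReal.ofReal_le_iff_le_toReal hfin]
  exact hv.trans (measure_mono fun t ht => ⟨ht.1, hx.trans ht.2⟩)

lemma bellman_eq {x : ℝ} (hx : x ∈ Icc (0 : ℝ) 1) : bellman x = 1 - bridgeInv x := by
  have hhalf : (1 / 2 : ℝ) ∈ dyadicPoints := mem_iUnion.2 ⟨0, 1, by norm_num, by norm_num⟩
  have hI := bridgeInv_mem hx
  apply le_antisymm
  · refine csSup_le ?_ ?_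
    · obtain ⟨f, hf, -⟩ := (attains_bridgeSeq 0 0 (by norm_num)).exists_isTestFunction
      exact ⟨_, f, hf, rfl⟩
    · rintro m ⟨f, hf, rfl⟩
      exact volume_real_ge_le hf hx
  · rcases hI.2.eq_or_lt with h | h
    · rw [h]
      exact le_bellman hhalf (by rw [suspensionBridge_half]; exact hx.2)
    · refine le_of_forall_lt fun c hc => ?_
      -- a dyadic point slightly to the right of `bridgeInv x`
      obtain ⟨s, hs1, hs2⟩ := exists_between (lt_min (show bridgeInv x < 1 - c by linarith) h)
      have hs3 := hs2.trans_le (min_le_left _ _)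
      have hs4 := hs2.trans_le (min_le_right _ _)
      have hsI : s ∈ Icc (0 : ℝ) (1 / 2) := ⟨hI.1.trans hs1.le, hs4.le⟩
      obtain ⟨n, hn⟩ := ((tendsto_dyadicFloor hsI.1).eventually (lt_mem_nhds hs1)).exists
      have hle := dyadicFloor_le hsI.1 n
      refine lt_of_lt_of_le ?_ (le_bellman (dyadicFloor_mem_dyadicPoints hsI n)
        ((bridgeInv_le_iff hx (dyadicFloor_mem hsI n)).1 hn.le))
      linarith

/-! ### One-sided derivatives of the inverse bridge -/

lemma ConcaveOn.convexOn_invFunOn {f : ℝ → ℝ} {s u : Set ℝ} (hf : ConcaveOn ℝ s f)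
    (hm : StrictMonoOn f s) (hb : BijOn f s u) (hu : Convex ℝ u) :
    ConvexOn ℝ u (Function.invFunOn f s) := by
  have hmem : ∀ {x}, x ∈ u → Function.invFunOn f s x ∈ s := fun hx =>
    Function.invFunOn_mem (hb.surjOn hx)
  have heq : ∀ {x}, x ∈ u → f (Function.invFunOn f s x) = x := fun hx =>
    Function.invFunOn_eq (hb.surjOn hx)
  refine ⟨hu, fun x hx y hy a b ha hb' hab => ?_⟩
  have hz := hu hx hy ha hb' hab
  have h := hf.2 (hmem hx) (hmem hy) ha hb' hab
  rw [heq hx, heq hy, ← heq hz] at h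
  exact (hm.le_iff_le (hmem hz) (hf.1 (hmem hx) (hmem hy) ha hb' hab)).1 h

/-- Measured in the cubic scale, the inverse bridge is convex. -/
lemma exists_convex_bridgeInv : ∃ g : ℝ → ℝ, ConvexOn ℝ (Icc 0 (5 / 6)) g ∧
    ∀ x ∈ Icc (0 : ℝ) 1, g (cubicScale x) = bridgeInv x := by
  have hm : StrictMonoOn (fun t => cubicScale (suspensionBridge t)) (Icc 0 (1 / 2)) :=
    cubicScale_strictMonoOn.comp strictMonoOn_suspensionBridge bijOn_suspensionBridge.mapsTo
  have hc : BijOn cubicScale (Icc 0 1) (Icc 0 (5 / 6)) := by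
    refine ⟨fun x hx => ⟨?_, ?_⟩, cubicScale_strictMonoOn.injOn, ?_⟩
    · have := cubicScale_strictMonoOn.monotoneOn ⟨le_rfl, zero_le_one⟩ hx hx.1
      simpa [cubicScale] using this
    · have := cubicScale_strictMonoOn.monotoneOn hx ⟨zero_le_one, le_rfl⟩ hx.2
      refine this.trans (by norm_num [cubicScale])
    · have := intermediate_value_Icc (zero_le_one (α := ℝ)) continuous_cubicScale.continuousOn
      norm_num [cubicScale] at this
      exact this
  have hb := hc.comp bijOn_suspensionBridge
  refine ⟨_, concaveOn_cubicScale_bridge.convexOn_invFunOn hm hb (convex_Icc _ _), fun x hx => ?_⟩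
  have h := hm.injOn.leftInvOn_invFunOn (bridgeInv_mem hx)
  simp only [suspensionBridge_bridgeInv hx] at h
  exact h

/-- The inverse bridge has one-sided derivatives, and the left one does not vanish. -/
lemma exists_hasDerivWithinAt_bridgeInv {x : ℝ} (hx : x ∈ Ioo (0 : ℝ) 1) :
    ∃ l r : ℝ, 0 < l ∧ HasDerivWithinAt bridgeInv l (Iio x) x ∧
      HasDerivWithinAt bridgeInv r (Ioi x) x := by
  obtain ⟨g, hg, hgT⟩ := exists_convex_bridgeInv
  have hx' : x ∈ Icc (0 : ℝ) 1 := Ioo_subset_Icc_self hx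
  have c0 : cubicScale 0 = 0 := by norm_num [cubicScale]
  have c1 : cubicScale 1 = 5 / 6 := by norm_num [cubicScale]
  have h0 : (0 : ℝ) ∈ Icc (0 : ℝ) 1 := ⟨le_rfl, zero_le_one⟩
  have hpos : 0 < cubicScale x := by
    rw [← c0]; exact cubicScale_strictMonoOn h0 hx' hx.1
  have hlt : cubicScale x < 5 / 6 := by
    rw [← c1]; exact cubicScale_strictMonoOn hx' ⟨zero_le_one, le_rfl⟩ hx.2
  have hint : cubicScale x ∈ interior (Icc (0 : ℝ) (5 / 6)) := by
    rw [interior_Icc]; exact ⟨hpos, hlt⟩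
  have hL := hg.hasDerivWithinAt_leftDeriv_of_mem_interior hint
  have hR := hg.hasDerivWithinAt_rightDeriv_of_mem_interior hint
  have hl : 0 < derivWithin g (Iio (cubicScale x)) (cubicScale x) := by
    refine lt_of_lt_of_le ?_ (hg.slope_le_leftDeriv_of_mem_interior
      (⟨le_rfl, by norm_num⟩ : (0 : ℝ) ∈ Icc (0 : ℝ) (5 / 6)) hint hpos)
    have e0 : g 0 = 0 := by
      have := hgT 0 h0
      rwa [c0, bridgeInv_of_nonpos le_rfl] at this
    have e1 : 0 < bridgeInv x := by
      rw [← bridgeInv_of_nonpos (le_refl (0 : ℝ))]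
      exact strictMonoOn_bridgeInv h0 hx' hx.1
    rw [slope_def_field, hgT x hx', e0, sub_zero, sub_zero]
    exact div_pos e1 hpos
  have hc : HasDerivAt cubicScale (1 - x ^ 2 / 2) x := by
    have := (hasDerivAt_id x).sub ((hasDerivAt_pow 3 x).div_const 6)
    refine this.congr_deriv ?_
    norm_num; ring
  have hc0 : 0 < 1 - x ^ 2 / 2 := by nlinarith [hx.1, hx.2]
  refine ⟨_, derivWithin g (Ioi (cubicScale x)) (cubicScale x) * (1 - x ^ 2 / 2),
    mul_pos hl hc0, ?_, ?_⟩
  · have h := hL.comp x (hc.hasDerivWithinAt (s := Ioo 0 x))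
      (fun y hy => cubicScale_strictMonoOn ⟨hy.1.le, hy.2.le.trans hx.2.le⟩ hx' hy.2)
    refine (h.congr (fun y hy => ?_) (hgT x hx').symm).mono_of_mem_nhdsWithin
      (Ioo_mem_nhdsLT hx.1)
    exact (hgT y ⟨hy.1.le, hy.2.le.trans hx.2.le⟩).symm
  · have h := hR.comp x (hc.hasDerivWithinAt (s := Ioo x 1))
      (fun y hy => cubicScale_strictMonoOn hx' ⟨hx.1.le.trans hy.1.le, hy.2.le⟩ hy.1)
    refine (h.congr (fun y hy => ?_) (hgT x hx').symm).mono_of_mem_nhdsWithin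
      (Ioo_mem_nhdsGT hx.2)
    exact (hgT y ⟨hx.1.le.trans hy.1.le, hy.2.le⟩).symm

/-! ### Derivative jumps at the dyadic points -/

/-- `IsInnerDyadic m t` says that `t` is a point of the `m`-th dyadic grid in `(0, 1/2)`. -/
def IsInnerDyadic (m : ℕ) (t : ℝ) : Prop :=
  ∃ k : ℕ, 0 < k ∧ k < 2 ^ m ∧ t = (k : ℝ) / 2 ^ (m + 1)

lemma IsInnerDyadic.add {m : ℕ} {t : ℝ} (h : IsInnerDyadic m t) (j : ℕ) :
    IsInnerDyadic (m + j) t := by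
  obtain ⟨k, h0, h1, rfl⟩ := h
  refine ⟨k * 2 ^ j, by positivity, by rw [pow_add]; gcongr, ?_⟩
  push_cast
  rw [show m + j + 1 = m + 1 + j by ring, pow_add 2 (m + 1) j]
  field_simp

lemma IsInnerDyadic.mem {m : ℕ} {t : ℝ} (h : IsInnerDyadic m t) :
    t - 1 / 2 ^ (m + 1) ∈ Icc (0 : ℝ) (1 / 2) ∧ t ∈ Ioo (0 : ℝ) (1 / 2) ∧
      t + 1 / 2 ^ (m + 1) ∈ Icc (0 : ℝ) (1 / 2) := by
  obtain ⟨k, h0, h1, rfl⟩ := h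
  have hp : (0 : ℝ) < 2 ^ m := by positivity
  have e0 : (1 : ℝ) ≤ k := by exact_mod_cast h0
  have e1 : (k : ℝ) + 1 ≤ 2 ^ m := by exact_mod_cast h1
  rw [← sub_div, ← add_div, pow_succ]
  refine ⟨⟨?_, ?_⟩, ⟨?_, ?_⟩, ?_, ?_⟩
  · apply div_nonneg <;> linarith
  · rw [div_le_iff₀ (by positivity)]; linarith
  · positivity
  · rw [div_lt_iff₀ (by positivity)]; linarith
  · positivity
  · rw [div_le_iff₀ (by positivity)]; linarith

lemma IsInnerDyadic.bridge_left {m : ℕ} {t : ℝ} (h : IsInnerDyadic m t) :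
    suspensionBridge (t - 1 / 2 ^ (m + 2)) =
      nonlinearMean (suspensionBridge (t - 1 / 2 ^ (m + 1))) (suspensionBridge t) := by
  obtain ⟨k, h0, h1, rfl⟩ := h
  obtain ⟨k, rfl⟩ := Nat.exists_eq_succ_of_ne_zero h0.ne'
  rw [suspensionBridge_midpoint (n := m) (k := k) (by omega)]
  · congr 2 <;> rw [pow_succ _ (m + 1)] <;> push_cast <;> field_simp <;> ring
  · rw [pow_succ _ (m + 1)]; push_cast; field_simp; ring

lemma IsInnerDyadic.bridge_right {m : ℕ} {t : ℝ} (h : IsInnerDyadic m t) :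
    suspensionBridge (t + 1 / 2 ^ (m + 2)) =
      nonlinearMean (suspensionBridge t) (suspensionBridge (t + 1 / 2 ^ (m + 1))) := by
  obtain ⟨k, h0, h1, rfl⟩ := h
  rw [suspensionBridge_midpoint (n := m) (k := k) h1]
  · congr 2 <;> rw [pow_succ _ (m + 1)] <;> field_simp <;> ring
  · rw [pow_succ _ (m + 1)]; field_simp

/-- The amount by which the bridge at `t` exceeds the nonlinear mean of its values at the
neighbours of `t` in the `m`-th grid. -/
noncomputable def bridgeExcess (m : ℕ) (t : ℝ) : ℝ :=
  suspensionBridge t - nonlinearMean (suspensionBridge (t - 1 / 2 ^ (m + 1)))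
    (suspensionBridge (t + 1 / 2 ^ (m + 1)))

lemma IsInnerDyadic.lt {m : ℕ} {t : ℝ} (h : IsInnerDyadic m t) :
    suspensionBridge (t - 1 / 2 ^ (m + 1)) < suspensionBridge t ∧
      suspensionBridge t < suspensionBridge (t + 1 / 2 ^ (m + 1)) := by
  obtain ⟨h1, h2, h3⟩ := h.mem
  have hp : (0 : ℝ) < 1 / 2 ^ (m + 1) := by positivity
  exact ⟨strictMonoOn_suspensionBridge h1 (Ioo_subset_Icc_self h2) (by linarith),
    strictMonoOn_suspensionBridge (Ioo_subset_Icc_self h2) h3 (by linarith)⟩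

/-- Refining the grid at most halves the excess: this is the four-point inequality with its two
middle points equal. -/
lemma IsInnerDyadic.half_bridgeExcess_le {m : ℕ} {t : ℝ} (h : IsInnerDyadic m t) :
    bridgeExcess m t / 2 ≤ bridgeExcess (m + 1) t := by
  obtain ⟨h1, h2, h3⟩ := h.mem
  obtain ⟨l1, l2⟩ := h.lt
  have h0 := suspensionBridge_nonneg h1
  have key := nonlinearMean_four_point h0 l1.le le_rfl l2.le (suspensionBridge_le_one h3)
  rw [nonlinearMean_self, ← h.bridge_left, ← h.bridge_right] at key
  have h4 := nonlinearMean_nonneg (add_nonneg h0 (suspensionBridge_nonneg h3))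
  have h5 := nonlinearMean_le_avg (add_nonneg h4 (h0.trans l1.le))
  unfold bridgeExcess
  linarith

lemma IsInnerDyadic.bridgeExcess_nonneg {m : ℕ} {t : ℝ} (h : IsInnerDyadic m t) :
    0 ≤ bridgeExcess m t := by
  obtain ⟨h1, h2, h3⟩ := h.mem
  have := suspensionBridge_three_point h1 h3
  rw [show (t - 1 / 2 ^ (m + 1) + (t + 1 / 2 ^ (m + 1))) / 2 = t by ring] at this
  exact sub_nonneg.2 this

/-- On the next grid the excess is positive, by the strict four-point inequality. -/
lemma IsInnerDyadic.bridgeExcess_succ_pos {m : ℕ} {t : ℝ} (h : IsInnerDyadic m t) :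
    0 < bridgeExcess (m + 1) t := by
  obtain ⟨h1, h2, h3⟩ := h.mem
  obtain ⟨l1, l2⟩ := h.lt
  have h0 := suspensionBridge_nonneg h1
  have key := nonlinearMean_four_point_strict h0 l1 l2 (suspensionBridge_le_one h3)
  rw [← h.bridge_left, ← h.bridge_right] at key
  have h4 := nonlinearMean_nonneg (add_nonneg h0 (suspensionBridge_nonneg h3))
  have h5 := nonlinearMean_mono h4 (h0.trans l1.le) (sub_nonneg.1 h.bridgeExcess_nonneg) le_rfl
    (suspensionBridge_le_one (Ioo_subset_Icc_self h2))
    (suspensionBridge_le_one (Ioo_subset_Icc_self h2))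
  rw [nonlinearMean_self] at h5
  exact sub_pos.2 (key.trans_le h5)

lemma IsInnerDyadic.bridgeExcess_ge {m : ℕ} {t : ℝ} (h : IsInnerDyadic m t) (j : ℕ) :
    bridgeExcess m t * 2 ^ (m + 1) ≤ bridgeExcess (m + j) t * 2 ^ (m + j + 1) := by
  induction j with
  | zero => rfl
  | succ j ih =>
    refine ih.trans ?_
    have := (h.add j).half_bridgeExcess_le
    rw [← add_assoc, pow_succ _ (m + j + 1)]
    nlinarith [pow_pos (two_pos : (0 : ℝ) < 2) (m + j + 1)]

/-- The increments of the bridge to the left and to the right of an inner dyadic point differ by at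
least twice the excess, up to a quadratic error. -/
lemma IsInnerDyadic.increments {m : ℕ} {t : ℝ} (h : IsInnerDyadic m t) :
    2 * bridgeExcess m t - (suspensionBridge (t + 1 / 2 ^ (m + 1)) -
        suspensionBridge (t - 1 / 2 ^ (m + 1))) ^ 2 / 4 ≤
      (suspensionBridge t - suspensionBridge (t - 1 / 2 ^ (m + 1))) -
        (suspensionBridge (t + 1 / 2 ^ (m + 1)) - suspensionBridge t) := by
  obtain ⟨h1, h2, h3⟩ := h.mem
  have a0 := suspensionBridge_nonneg h1
  have b0 := suspensionBridge_nonneg h3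
  have a1 := suspensionBridge_le_one h1
  have b1 := suspensionBridge_le_one h3
  have := le_nonlinearMean (add_nonneg a0 b0)
  unfold bridgeExcess
  set a := suspensionBridge (t - 1 / 2 ^ (m + 1))
  set b := suspensionBridge (t + 1 / 2 ^ (m + 1))
  nlinarith [mul_nonneg (by linarith : 0 ≤ 2 - a - b) (sq_nonneg (b - a))]

/-- If `s j → t` one-sidedly, the difference quotients of the bridge along `s` converge to the
inverse of the one-sided derivative of the inverse bridge. -/
lemma tendsto_slope_bridge {t d : ℝ} {s : ℕ → ℝ} {u : Set ℝ} (ht : t ∈ Icc (0 : ℝ) (1 / 2))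
    (hd : d ≠ 0) (hu : suspensionBridge t ∉ u)
    (h : HasDerivWithinAt bridgeInv d u (suspensionBridge t))
    (hs : ∀ j, s j ∈ Icc (0 : ℝ) (1 / 2)) (hsu : ∀ j, suspensionBridge (s j) ∈ u)
    (hst : Tendsto s atTop (𝓝 t)) :
    Tendsto (fun j => (suspensionBridge (s j) - suspensionBridge t) / (s j - t)) atTop
      (𝓝 d⁻¹) := by
  have hA : Tendsto (fun j => suspensionBridge (s j)) atTop (𝓝 (suspensionBridge t)) :=
    (continuousOn_suspensionBridge t ht).tendsto.comp
      (tendsto_nhdsWithin_iff.2 ⟨hst, Eventually.of_forall hs⟩)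
  have h1 := ((hasDerivWithinAt_iff_tendsto_slope' hu).1 h).comp
    (tendsto_nhdsWithin_iff.2 ⟨hA, Eventually.of_forall hsu⟩)
  refine (h1.inv₀ hd).congr fun j => ?_
  simp only [Function.comp, slope_def_field, bridgeInv_suspensionBridge ht,
    bridgeInv_suspensionBridge (hs j), inv_div]

lemma IsInnerDyadic.hasDerivJumpAt {m : ℕ} {t : ℝ} (h : IsInnerDyadic m t) :
    HasDerivJumpAt bellman (suspensionBridge t) := by
  have htI : t ∈ Icc (0 : ℝ) (1 / 2) := Ioo_subset_Icc_self h.mem.2.1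
  have hx : suspensionBridge t ∈ Ioo (0 : ℝ) 1 := by
    constructor
    · exact (suspensionBridge_nonneg h.mem.1).trans_lt h.lt.1
    · exact h.lt.2.trans_le (suspensionBridge_le_one h.mem.2.2)
  obtain ⟨l, r, hl, hL, hR⟩ := exists_hasDerivWithinAt_bridgeInv hx
  have hev : bellman =ᶠ[𝓝 (suspensionBridge t)] fun x => 1 - bridgeInv x := by
    filter_upwards [Ioo_mem_nhds hx.1 hx.2] with x hx
    exact bellman_eq (Ioo_subset_Icc_self hx)
  refine ⟨-l, -r,
    (hL.const_sub 1).congr_of_eventuallyEq (hev.filter_mono nhdsWithin_le_nhds) hev.self_of_nhds,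
    (hR.const_sub 1).congr_of_eventuallyEq (hev.filter_mono nhdsWithin_le_nhds) hev.self_of_nhds,
    fun heq => ?_⟩
  obtain rfl : l = r := neg_injective heq
  have hδ : Tendsto (fun j : ℕ => (1 : ℝ) / 2 ^ (m + 1 + j + 1)) atTop (𝓝 0) := by
    have := (tendsto_add_atTop_iff_nat (m + 1)).2 tendsto_one_div_two_pow
    refine this.congr fun j => ?_
    rw [add_comm j]
  have hp := tendsto_slope_bridge (s := fun j => t - 1 / 2 ^ (m + 1 + j + 1)) htI hl.ne'
    self_notMem_Iio hL (fun j => ((h.add 1).add j).mem.1) (fun j => ((h.add 1).add j).lt.1)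
    (by simpa using hδ.const_sub t)
  have hq := tendsto_slope_bridge (s := fun j => t + 1 / 2 ^ (m + 1 + j + 1)) htI hl.ne'
    self_notMem_Ioi hR (fun j => ((h.add 1).add j).mem.2.2) (fun j => ((h.add 1).add j).lt.2)
    (by simpa using hδ.const_add t)
  -- The two difference quotients have the same limit and the quadratic error vanishes, while the
  -- rescaled excess stays above a positive constant.
  have hlim := (hp.sub hq).add ((((hp.add hq).pow 2).mul hδ).div_const 4)
  rw [sub_self, mul_zero, zero_div, add_zero] at hlim
  have hpos : 0 < 2 * (bridgeExcess (m + 1) t * 2 ^ (m + 1 + 1)) := by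
    have := h.bridgeExcess_succ_pos
    positivity
  refine absurd (ge_of_tendsto' hlim fun j => ?_) (not_le.2 hpos)
  have h1 := (h.add 1).bridgeExcess_ge j
  have h2 := ((h.add 1).add j).increments
  refine (mul_le_mul_of_nonneg_left h1 zero_le_two).trans ?_
  set a := suspensionBridge (t - 1 / 2 ^ (m + 1 + j + 1))
  set b := suspensionBridge (t + 1 / 2 ^ (m + 1 + j + 1))
  set x := suspensionBridge t
  have hP : (0 : ℝ) < 2 ^ (m + 1 + j + 1) := by positivity
  have e1 : (a - x) / (t - 1 / 2 ^ (m + 1 + j + 1) - t) = (x - a) * 2 ^ (m + 1 + j + 1) := by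
    rw [show t - 1 / 2 ^ (m + 1 + j + 1) - t = -(1 / 2 ^ (m + 1 + j + 1)) by ring]
    field_simp
    ring
  have e2 : (b - x) / (t + 1 / 2 ^ (m + 1 + j + 1) - t) = (b - x) * 2 ^ (m + 1 + j + 1) := by
    rw [add_sub_cancel_left]
    field_simp
  rw [e1, e2]
  have e3 : ((x - a) * 2 ^ (m + 1 + j + 1) + (b - x) * 2 ^ (m + 1 + j + 1)) ^ 2 *
      (1 / 2 ^ (m + 1 + j + 1)) / 4 = (b - a) ^ 2 / 4 * 2 ^ (m + 1 + j + 1) := by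
    field_simp
    ring
  rw [e3]
  nlinarith [mul_le_mul_of_nonneg_right h2 hP.le]

/-- The values of the bridge at the inner dyadic points are dense. -/
lemma Icc_subset_closure_jumps :
    Icc (0 : ℝ) 1 ⊆ closure {x | x ∈ Ioo (0 : ℝ) 1 ∧ HasDerivJumpAt bellman x} := by
  have hI : Icc (0 : ℝ) 1 ⊆ closure (Ioo 0 1) := by rw [closure_Ioo zero_ne_one]
  refine hI.trans (closure_minimal (fun x hx => ?_) isClosed_closure)
  have hx' : x ∈ Icc (0 : ℝ) 1 := Ioo_subset_Icc_self hx
  have hT := bridgeInv_mem hx'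
  have hlim := tendsto_suspensionBridge_dyadicFloor hT
  rw [suspensionBridge_bridgeInv hx'] at hlim
  refine mem_closure_of_tendsto hlim ?_
  filter_upwards [hlim.eventually (Ioo_mem_nhds hx.1 hx.2)] with n hn
  refine ⟨hn, IsInnerDyadic.hasDerivJumpAt (m := n) ⟨_, ?_, ?_, rfl⟩⟩
  · by_contra! h0
    have : dyadicFloor n (bridgeInv x) = 0 := by
      unfold dyadicFloor; rw [Nat.le_zero.1 h0]; simp
    rw [this, suspensionBridge_zero] at hn
    exact lt_irrefl _ hn.1
  · refine lt_of_le_of_ne (floor_le_pow hT.2 n) fun h1 => ?_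
    have : dyadicFloor n (bridgeInv x) = 1 / 2 := by
      unfold dyadicFloor; rw [h1, pow_succ]; push_cast; field_simp
    rw [this, suspensionBridge_half] at hn
    exact lt_irrefl _ hn.2

/-- The first group of conjuncts says that the suspension bridge is well defined: it is continuous
on `[0, 1/2]`, has the prescribed end values, obeys the midpoint rule at the binary rationals
`t = (2 k + 1) / 2 ^ (n + 2)` with neighbours `t ± 2 ^ (-(n + 2))`, and is an increasing bijection
of `[0, 1/2]` onto `[0, 1]`. So `Function.invFunOn` below is its genuine inverse. -/
theorem mainTheorem1 :
    (suspensionBridge 0 = 0 ∧ suspensionBridge (1 / 2) = 1 ∧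
      (∀ n k : ℕ, k < 2 ^ n → ∀ t : ℝ, t = (2 * (k : ℝ) + 1) / 2 ^ (n + 2) →
        suspensionBridge t =
          nonlinearMean (suspensionBridge (t - 1 / 2 ^ (n + 2)))
            (suspensionBridge (t + 1 / 2 ^ (n + 2)))) ∧
      ContinuousOn suspensionBridge (Icc 0 (1 / 2)) ∧
      StrictMonoOn suspensionBridge (Icc 0 (1 / 2)) ∧
      BijOn suspensionBridge (Icc 0 (1 / 2)) (Icc 0 1)) ∧
    (∀ x ∈ Icc (0 : ℝ) 1,
      bellman x = 1 - Function.invFunOn suspensionBridge (Icc 0 (1 / 2)) x) ∧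
    Icc (0 : ℝ) 1 ⊆ closure {x | x ∈ Ioo (0 : ℝ) 1 ∧ HasDerivJumpAt bellman x} := by
  refine ⟨⟨suspensionBridge_zero, suspensionBridge_half, fun n k hk t ht =>
    suspensionBridge_midpoint hk ht, continuousOn_suspensionBridge, strictMonoOn_suspensionBridge,
    bijOn_suspensionBridge⟩, fun x hx => ?_, Icc_subset_closure_jumps⟩
  rw [bellman_eq hx, bridgeInv_of_mem hx]
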